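/- Let $p,q$ be odd primes with $p \mid q-1$, and let $G = C_q \rtimes C_p$ be the non-abelian group of order $pq$. A sequence over $G$ is a finite multiset of elements of $G$, written $g_1 \boldsymbol{\cdot} \ldots \boldsymbol{\cdot} g_k$, where $g^{[m]}$ means $g$ repeated $m$ times; it is product-one if its terms can be ordered so that their product in $G$ is $1$, and minimal product-one if it is product-one and is not the concatenation (multiset sum) of two nonempty product-one sequences. Theorem. A sequence $S$ over $G$ is a minimal product-one sequence of length $2q$ if and only if there exist $x,y \in G$ and a positive integer $s$ of multiplicative order $p$ modulo $q$ such that $G$ has the presentation $$G = \langle x,y : x^p = y^q = 1,\ yx = xy^s \rangle$$ and $$S = y^{[q-1]} \boldsymbol{\cdot} x \boldsymbol{\cdot} y^{[q-1]} \boldsymbol{\cdot} x^{p-1}y^{s^{p-1}+1}.$$ -/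

import Mathlib

/-- A sequence over `G` is a finite multiset of elements of `G`. It is product-one if its terms
can be ordered so that their product is the identity. -/
def IsProductOne {G : Type*} [Group G] (S : Multiset G) : Prop :=
  ∃ l : List G, (l : Multiset G) = S ∧ l.prod = 1

/-- A product-one sequence that is not the concatenation of two nontrivial product-one
sequences. -/
def IsMinimalProductOne {G : Type*} [Group G] (S : Multiset G) : Prop :=
  IsProductOne S ∧
    ∀ T₁ T₂ : Multiset G, T₁ ≠ 0 → T₂ ≠ 0 → IsProductOne T₁ → IsProductOne T₂ → S ≠ T₁ + T₂

/-- The relators of the presentation `⟨x, y : x ^ p = y ^ q = 1, y x = x y ^ s⟩`, where the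
generator `0` is `x` and the generator `1` is `y`. -/
def metacyclicRelators (p q s : ℕ) : Set (FreeGroup (Fin 2)) :=
  {FreeGroup.of 0 ^ p, FreeGroup.of 1 ^ q,
    FreeGroup.of 1 * FreeGroup.of 0 * (FreeGroup.of 0 * FreeGroup.of 1 ^ s)⁻¹}

/-- `G = ⟨x, y : x ^ p = y ^ q = 1, y x = x y ^ s, ord_q(s) = p⟩`: the exponent `s` has
multiplicative order `p` modulo `q`, and `G` is presented, with its elements `x` and `y` as the
two generators, by the relations `x ^ p = y ^ q = 1` and `y x = x y ^ s`. -/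
def HasStandardPresentation {G : Type*} [Group G] (p q s : ℕ) (x y : G) : Prop :=
  orderOf (s : ZMod q) = p ∧
    ∃ e : PresentedGroup (metacyclicRelators p q s) ≃* G,
      e (PresentedGroup.of 0) = x ∧ e (PresentedGroup.of 1) = y

/-!
The group `G` is identified with a group of affine maps of `ZMod q` (`AffineCoord`): an element `g`
has a label `ℓ g` in `ZMod p`, which determines its linear part, and a translation part `β g`. The
elements of label `0` form the normal subgroup `N` of order `q`. A sequence is product-one if and
only if its labels sum to `0` and `0` is among the values of the sequence, that is, the translation
parts of the products of its orderings (`isProductOne_iff`).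

Let `S` be a minimal product-one sequence of length `2 * q`. It is split, for a contradiction, into
a product-one subsequence and a complement that attains every value (`not_split`). Values are
counted by the Cauchy–Davenport inequality in `ZMod q`. A minimal label-zero sequence (a piece) of
length `m` can be rotated, and inserted after any prefix of a given ordering; if the prefixes of
that ordering have `n` different labels, this shifts the translation part in at least
`min p (n + m - 1)` ways (`insertions_card`), by Cauchy–Davenport in `ZMod p`. Iterating gives
`reach_card` and `subreach_card`; the second counts the values of subsequences and so finds
product-one subsequences of controlled length.

With `q = 2 * k * p + 1`, these counts show that exactly two terms of `S` lie outside `N`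
(`card_label_ne_zero`). If the terms outside `N` form a single piece, or if `N` contains at least
`3 * k * p` terms, the count is direct (`false_of_isPiece`, `false_of_normal_dominated`). If some
product-one subsequence has length at most `p`, then its complement is cut into blocks of size `p`,
each containing a noncommuting pair and hence having at least `p` values (`false_of_short`).
Otherwise every piece of `S` can be inserted with a nonzero effect. A label-zero sequence of length
at least `q + 1` then has the value `0` (`zero_mem_vals_of_long`; the set of shifts is a union of
orbits of size `p`, which improves the Cauchy–Davenport bound). So it is enough to find a product-one
subsequence of length less than `q`, and this is done from the terms in `N` if there are at least
`k * p` of them (`false_of_normal_half`), from `p` terms with a common label if that label is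
frequent (`card_label_lt`), and from pieces of length at most `(p + 1) / 2` otherwise
(`false_of_normal_lt`).

The remaining `2 * q - 2` terms are all equal to one `y`, since two different ones would lead to a
zero-sum subsequence of length less than `q` in `N` (`eq_of_label_zero`). A product-one ordering
`x y ^ a x' y ^ b` must have `a = b = q - 1`, for otherwise `q` copies of `y` split off
(`exists_eq_replicate`). Hence `x' = y * x⁻¹ * y`, the last term of the asserted form.
Conversely, the minimality of such a sequence and the presentation of `G` are verified with the
normal form of the elements of `G` as products of a power of `y` and a power of `x`.
-/

/-! ### Sumsets and zero-sum selections modulo a prime -/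

open scoped Pointwise in
/-- Cauchy–Davenport for a sumset contained in `C`, with lower bounds for the summands in place of
their sizes; the shape of the bound on `A` is that of the conclusion, so that it iterates. -/
theorem cauchyDavenport_step {r : ℕ} [Fact r.Prime] {A B C : Set (ZMod r)} {x y : ℕ}
    (hA : min r (x + 1) ≤ A.ncard) (hB : y + 1 ≤ B.ncard)
    (h : ∀ a ∈ A, ∀ b ∈ B, a + b ∈ C) : min r (x + y + 1) ≤ C.ncard := by
  classical
  have hr : r.Prime := Fact.out
  have hr2 := hr.two_le
  have hA' : A.toFinset.Nonempty := by
    rw [Set.toFinset_nonempty]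
    apply Set.nonempty_of_ncard_ne_zero
    omega
  have hB' : B.toFinset.Nonempty := by
    rw [Set.toFinset_nonempty]
    apply Set.nonempty_of_ncard_ne_zero
    omega
  have hcd := ZMod.cauchy_davenport hr hA' hB'
  rw [← Set.ncard_eq_toFinset_card', ← Set.ncard_eq_toFinset_card'] at hcd
  have hsub : A.toFinset + B.toFinset ⊆ C.toFinset := by
    intro z hz
    obtain ⟨a, ha, b, hb, rfl⟩ := Finset.mem_add.1 hz
    rw [Set.mem_toFinset] at *
    exact h a ha b hb
  have hle := Finset.card_le_card hsub
  rw [← Set.ncard_eq_toFinset_card'] at hle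
  omega

theorem mem_of_min_le_ncard {r : ℕ} [Fact r.Prime] {A : Set (ZMod r)} {x : ℕ}
    (hA : min r x ≤ A.ncard) (hx : r ≤ x) (v : ZMod r) : v ∈ A := by
  have hr : A.ncard = r := by
    apply le_antisymm
    · simpa [ZMod.card] using Set.ncard_le_card A
    · simpa [hx] using hA
  have : A = Set.univ := by
    apply Set.eq_of_subset_of_ncard_le (Set.subset_univ _)
    rw [hr, Set.ncard_univ, Nat.card_zmod]
  rw [this]; trivial

/-- Distributing a multiset in which every value of `w` occurs at most `h` times into `h`
parts on which `w` is injective; the parts are nonempty once there are enough elements. -/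
theorem exists_partition_injOn {α κ : Type*} [DecidableEq κ] (w : α → κ) (h : ℕ) (V : Multiset α)
    (hV : ∀ a, (V.map w).count a ≤ h) :
    ∃ L : List (Multiset α), L.length = h ∧ L.sum = V ∧ (∀ B ∈ L, (B.map w).Nodup) ∧
      (h ≤ V.card → ∀ B ∈ L, B ≠ 0) := by
  classical
  have key : ∃ L : List (Multiset α), L.length = h ∧ L.sum = V ∧ (∀ B ∈ L, (B.map w).Nodup) ∧
      ((∀ B ∈ L, B ≠ 0) ∨ ∀ B ∈ L, B.card ≤ 1) := by
    induction V using Multiset.induction with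
    | empty =>
      refine ⟨List.replicate h 0, by simp, by simp, ?_, Or.inr ?_⟩
      · intro B hB; rw [List.eq_of_mem_replicate hB]; simp
      · intro B hB; rw [List.eq_of_mem_replicate hB]; simp
    | cons a V ih =>
      obtain ⟨L, hL, hs, hn, hor⟩ := ih fun b => le_trans
        (Multiset.count_le_of_le b (by simp [Multiset.le_cons_self])) (hV b)
      -- adding `a` to a part
      have put : ∀ B ∈ L, w a ∉ B.map w → ∃ L' : List (Multiset α), L'.length = h ∧
          L'.sum = a ::ₘ V ∧ (∀ B ∈ L', (B.map w).Nodup) ∧ ∀ C ∈ L', C ∈ L ∨ C = a ::ₘ B := by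
        intro B hB ha
        obtain ⟨L1, L2, rfl⟩ := List.append_of_mem hB
        refine ⟨L1 ++ (a ::ₘ B) :: L2, by simpa using hL, ?_, ?_, ?_⟩
        · rw [← hs]; simp [← Multiset.singleton_add]; abel
        · intro C hC
          simp only [List.mem_append, List.mem_cons] at hC hn
          rcases hC with hC | rfl | hC
          · exact hn _ (Or.inl hC)
          · rw [Multiset.map_cons, Multiset.nodup_cons]
            exact ⟨ha, hn _ (Or.inr (Or.inl rfl))⟩
          · exact hn _ (Or.inr (Or.inr hC))
        · intro C hC
          simp only [List.mem_append, List.mem_cons] at hC ⊢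
          tauto
      by_cases he : ∃ B ∈ L, B = 0
      · obtain ⟨B, hB, rfl⟩ := he
        have h1 : ∀ B ∈ L, B.card ≤ 1 := by
          rcases hor with h0 | h1
          · exact absurd rfl (h0 _ hB)
          · exact h1
        obtain ⟨L', h1', h2', h3', h4'⟩ := put 0 hB (by simp)
        refine ⟨L', h1', h2', h3', Or.inr fun C hC => ?_⟩
        rcases h4' C hC with h5 | rfl
        · exact h1 _ h5
        · simp
      · push Not at he
        have hex : ∃ B ∈ L, w a ∉ B.map w := by
          by_contra hcon
          push Not at hcon
          have hc : ∀ L : List (Multiset α), (∀ B ∈ L, w a ∈ B.map w) →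
              L.length ≤ (L.sum.map w).count (w a) := by
            intro L
            induction L with
            | nil => simp
            | cons B L ih =>
              intro hB
              have h1 := ih fun C hC => hB C (List.mem_cons_of_mem _ hC)
              have h2 : 0 < (B.map w).count (w a) :=
                Multiset.count_pos.2 (hB B List.mem_cons_self)
              simp only [List.length_cons, List.sum_cons, Multiset.map_add, Multiset.count_add]
              omega
          have h1 := hc L hcon
          have h2 := hV (w a)
          rw [Multiset.map_cons, Multiset.count_cons_self] at h2
          rw [hs] at h1
          omega
        obtain ⟨B, hB, ha⟩ := hex
        obtain ⟨L', h1', h2', h3', h4'⟩ := put B hB ha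
        refine ⟨L', h1', h2', h3', Or.inl fun C hC => ?_⟩
        rcases h4' C hC with h5 | rfl
        · exact he _ h5
        · simp
  obtain ⟨L, hL, hs, hn, hor⟩ := key
  refine ⟨L, hL, hs, hn, fun hh B hB => ?_⟩
  rcases hor with h0 | h1
  · exact h0 B hB
  · rintro rfl
    have hc : ∀ L : List (Multiset α), (∀ B ∈ L, B.card ≤ 1) → (0 : Multiset α) ∈ L →
        L.sum.card < L.length := by
      intro L
      induction L with
      | nil => simp
      | cons B L ih =>
        intro hB h0
        rw [List.mem_cons] at h0
        have hle : ∀ L : List (Multiset α), (∀ B ∈ L, B.card ≤ 1) → L.sum.card ≤ L.length := by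
          intro L
          induction L with
          | nil => simp
          | cons B L ih =>
            intro h
            have := ih fun C hC => h C (List.mem_cons_of_mem _ hC)
            have := h B List.mem_cons_self
            simp only [List.sum_cons, Multiset.card_add, List.length_cons]; omega
        have h1 := hB B List.mem_cons_self
        have hB' : ∀ B ∈ L, B.card ≤ 1 := fun C hC => hB C (List.mem_cons_of_mem _ hC)
        simp only [List.sum_cons, Multiset.card_add, List.length_cons]
        rcases h0 with rfl | h0
        · have := hle L hB'; simp; omega
        · have := ih hB' h0; omega
    have := hc L h1 hB
    rw [hs, hL] at this
    omega

/-- Parts on which a weight `w` is injective, of total size at least `r`, contain a nonempty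
zero-sum selection with at most one element from each part. -/
theorem exists_zero_sum_selection {α : Type*} {r : ℕ} [Fact r.Prime] (w : α → ZMod r)
    (L : List (Multiset α)) (hn : ∀ B ∈ L, (B.map w).Nodup) (hc : r ≤ L.sum.card) :
    ∃ T : Multiset α, T ≠ 0 ∧ T ≤ L.sum ∧ T.card ≤ L.length ∧ (T.map w).sum = 0 := by
  classical
  by_contra hcon
  push Not at hcon
  have key : ∀ L' : List (Multiset α), L' <:+ L →
      L'.sum.card + 1 ≤
        {v | ∃ T : Multiset α, T ≤ L'.sum ∧ T.card ≤ L'.length ∧ (T.map w).sum = v}.ncard := by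
    intro L'
    induction L' with
    | nil =>
      intro _
      have : {v : ZMod r | ∃ T : Multiset α, T ≤ ([] : List (Multiset α)).sum ∧
          T.card ≤ ([] : List (Multiset α)).length ∧ (T.map w).sum = v} = {0} := by
        ext v
        simp [eq_comm]
      rw [this]
      simp
    | cons B L' ih =>
      intro hs
      have hs' : L' <:+ L := (List.suffix_cons B L').trans hs
      have hB : B ∈ L := hs.subset List.mem_cons_self
      have hnB := hn B hB
      have hBL : (B :: L').sum ≤ L.sum := by
        obtain ⟨L0, rfl⟩ := hs
        rw [List.sum_append]; exact Multiset.le_add_left _ _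
      have hBl : (B :: L').length ≤ L.length := hs.length_le
      have h1 := ih hs'
      set A := {v | ∃ T : Multiset α, T ≤ L'.sum ∧ T.card ≤ L'.length ∧ (T.map w).sum = v}
      have h0 : (0 : ZMod r) ∉ B.map w := by
        intro h0
        obtain ⟨g, hg, hg0⟩ := Multiset.mem_map.1 h0
        refine hcon {g} (by simp) ?_ ?_ (by simpa using hg0)
        · rw [Multiset.singleton_le]
          exact Multiset.mem_of_le (List.single_le_sum (by simp) B hB) hg
        · rw [Multiset.card_singleton]
          exact List.length_pos_of_mem hB
      have hBc : B.card + 1 ≤ (insert 0 {v | v ∈ B.map w} : Set (ZMod r)).ncard := by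
        have : {v | v ∈ B.map w} = ((B.map w).toFinset : Set (ZMod r)) := by ext; simp
        rw [this, Set.ncard_insert_of_notMem (by simpa using h0) (Set.toFinite _),
          Set.ncard_coe_finset, Multiset.toFinset_card_of_nodup hnB, Multiset.card_map]
      -- a further part avoids the negatives of the sums already attained
      have hBneg : {v | -v ∈ B.map w}.ncard = B.card := by
        have : {v | -v ∈ B.map w} =
            (((B.map w).toFinset.image (fun v => -v) : Finset (ZMod r)) : Set (ZMod r)) := by
          ext v
          simp only [Set.mem_ofPred_eq, Finset.coe_image, Set.mem_image, SetLike.mem_coe,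
            Multiset.mem_toFinset]
          constructor
          · intro h; exact ⟨-v, h, neg_neg v⟩
          · rintro ⟨u, hu, rfl⟩; simpa using hu
        rw [this, Set.ncard_coe_finset, Finset.card_image_of_injective _ neg_injective,
          Multiset.toFinset_card_of_nodup hnB, Multiset.card_map]
      have hdisj : Disjoint A {v | -v ∈ B.map w} := by
        rw [Set.disjoint_left]
        rintro v ⟨T, hT1, hT2, hTv⟩ hv
        obtain ⟨g, hg, hgv⟩ := Multiset.mem_map.1 hv
        refine hcon (g ::ₘ T) (by simp) (le_trans ?_ hBL)
          (le_trans (by simpa using hT2) hBl) (by simp [hgv, hTv])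
        rw [List.sum_cons, ← Multiset.singleton_add]
        exact add_le_add (Multiset.singleton_le.2 hg) hT1
      have hu := Set.ncard_union_eq hdisj (Set.toFinite _) (Set.toFinite _)
      have hle : (A ∪ {v | -v ∈ B.map w}).ncard ≤ r := by
        simpa [ZMod.card] using Set.ncard_le_card (A ∪ {v | -v ∈ B.map w})
      have := cauchyDavenport_step (C := {v | ∃ T : Multiset α, T ≤ (B :: L').sum ∧
        T.card ≤ (B :: L').length ∧ (T.map w).sum = v}) (A := A) (x := L'.sum.card)
        (min_le_of_right_le h1) hBc ?_
      · rw [List.sum_cons, Multiset.card_add] at *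
        omega
      · rintro a ⟨T, hT1, hT2, rfl⟩ b hb
        rcases hb with rfl | hb
        · exact ⟨T, by rw [List.sum_cons]; exact hT1.trans (Multiset.le_add_left _ _),
            by rw [List.length_cons]; omega, by simp⟩
        · obtain ⟨g, hg, rfl⟩ := Multiset.mem_map.1 hb
          refine ⟨g ::ₘ T, ?_, by simpa using hT2, by simp [add_comm]⟩
          rw [List.sum_cons, ← Multiset.singleton_add]
          exact add_le_add (Multiset.singleton_le.2 hg) hT1
  have h1 := key L List.suffix_rfl
  have h2 := Set.ncard_le_card
    {v | ∃ T : Multiset α, T ≤ L.sum ∧ T.card ≤ L.length ∧ (T.map w).sum = v}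
  rw [Nat.card_zmod] at h2
  omega

theorem Multiset.exists_le_card_eq {α : Type*} {S : Multiset α} {n : ℕ} (h : n ≤ S.card) :
    ∃ T ≤ S, T.card = n := by
  induction S using Quotient.inductionOn with
  | h l =>
    refine ⟨(l.take n : List α), Multiset.coe_le.2 (List.take_sublist _ _).subperm, ?_⟩
    change n ≤ l.length at h
    simpa using h

/-! ### Affine coordinates on the group -/

/-- Coordinates identifying `G` with a group of affine maps `z ↦ χ (ℓ g) * z + β g` of `ZMod q`,
whose linear parts are the values of an injective character `χ` of `ZMod p`. -/
structure AffineCoord (p q : ℕ) (G : Type*) [Group G] where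
  /-- the character giving the linear parts -/
  χ : AddChar (ZMod p) (ZMod q)
  χ_inj : Function.Injective χ
  /-- the label of an element: its image in the quotient `ZMod p` -/
  ℓ : G → ZMod p
  /-- the translation part of an element -/
  β : G → ZMod q
  ℓ_mul : ∀ g h, ℓ (g * h) = ℓ g + ℓ h
  β_mul : ∀ g h, β (g * h) = β g + χ (ℓ g) * β h
  eq_one : ∀ g, ℓ g = 0 → β g = 0 → g = 1

namespace AffineCoord

variable {p q : ℕ} {G : Type*} [Group G] (c : AffineCoord p q G)

theorem ℓ_one : c.ℓ 1 = 0 := by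
  have := c.ℓ_mul 1 1
  simpa using this

theorem χ_zero : c.χ 0 = 1 := AddChar.map_zero_eq_one _

theorem χ_add (a b : ZMod p) : c.χ (a + b) = c.χ a * c.χ b := AddChar.map_add_eq_mul _ _ _

theorem β_one : c.β 1 = 0 := by
  have := c.β_mul 1 1
  rw [c.ℓ_one, c.χ_zero] at this
  simpa using this

theorem χ_neg_mul (a : ZMod p) : c.χ (-a) * c.χ a = 1 := by
  rw [← c.χ_add, neg_add_cancel, c.χ_zero]

/-- The total label of a sequence. -/
def label (S : Multiset G) : ZMod p := (S.map c.ℓ).sum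

@[simp] theorem label_zero : c.label 0 = 0 := by simp [label]

@[simp] theorem label_add (S T : Multiset G) : c.label (S + T) = c.label S + c.label T := by
  simp [label]

@[simp] theorem label_cons (g : G) (S : Multiset G) :
    c.label (g ::ₘ S) = c.ℓ g + c.label S := by simp [label]

@[simp] theorem label_singleton (g : G) : c.label {g} = c.ℓ g := by simp [label]

theorem ℓ_prod (l : List G) : c.ℓ l.prod = c.label l := by
  induction l with
  | nil => simp [c.ℓ_one]
  | cons g l ih => rw [List.prod_cons, c.ℓ_mul, ih, ← Multiset.cons_coe, c.label_cons]

theorem label_sub {S T : Multiset G} [DecidableEq G] (h : T ≤ S) :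
    c.label (S - T) = c.label S - c.label T := by
  rw [eq_sub_iff_add_eq, ← c.label_add, Multiset.sub_add_cancel h]

/-- The translation parts of the products of the orderings of a sequence. -/
def vals (S : Multiset G) : Set (ZMod q) := {v | ∃ l : List G, (l : Multiset G) = S ∧ c.β l.prod = v}

theorem isProductOne_iff (S : Multiset G) :
    IsProductOne S ↔ c.label S = 0 ∧ (0 : ZMod q) ∈ c.vals S := by
  constructor
  · rintro ⟨l, rfl, hl⟩
    exact ⟨by rw [← c.ℓ_prod, hl, c.ℓ_one], l, rfl, by rw [hl, c.β_one]⟩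
  · rintro ⟨h, l, rfl, hl⟩
    exact ⟨l, rfl, c.eq_one _ (by rw [c.ℓ_prod, h]) hl⟩

theorem vals_add {S T : Multiset G} {a b : ZMod q} (ha : a ∈ c.vals S) (hb : b ∈ c.vals T) :
    a + c.χ (c.label S) * b ∈ c.vals (S + T) := by
  obtain ⟨l, rfl, rfl⟩ := ha
  obtain ⟨m, rfl, rfl⟩ := hb
  exact ⟨l ++ m, by simp, by rw [List.prod_append, c.β_mul, c.ℓ_prod]⟩

theorem vals_nonempty (S : Multiset G) : (c.vals S).Nonempty :=
  ⟨_, S.toList, by simp, rfl⟩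

/-- The labels of the prefixes of a list. -/
def prefixes (l : List G) : Set (ZMod p) := {κ | ∃ u v, l = u ++ v ∧ c.ℓ u.prod = κ}

theorem zero_mem_prefixes (l : List G) : (0 : ZMod p) ∈ c.prefixes l :=
  ⟨[], l, rfl, by simp [c.ℓ_one]⟩

/-- The translation parts of the products of those orderings of a sequence whose prefix labels
include the set `K`. -/
def reach (K : Set (ZMod p)) (S : Multiset G) : Set (ZMod q) :=
  {v | ∃ l : List G, (l : Multiset G) = S ∧ K ⊆ c.prefixes l ∧ c.β l.prod = v}

theorem reach_subset_vals (K : Set (ZMod p)) (S : Multiset G) : c.reach K S ⊆ c.vals S := by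
  rintro v ⟨l, h, -, hv⟩
  exact ⟨l, h, hv⟩

/-- Rotating a list of total label zero multiplies the translation part by a character value. -/
theorem β_rotate {u v : List G} (h : c.ℓ (u ++ v).prod = 0) :
    c.β (v ++ u).prod = c.χ (-c.ℓ u.prod) * c.β (u ++ v).prod := by
  have h1 : c.ℓ v.prod = -c.ℓ u.prod := by
    rw [List.prod_append, c.ℓ_mul] at h
    exact eq_neg_of_add_eq_zero_right h
  rw [List.prod_append, List.prod_append, c.β_mul, c.β_mul, h1, mul_add, ← mul_assoc,
    c.χ_neg_mul, one_mul, add_comm]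

/-- A rotation of a label-zero sequence can be inserted after any prefix of an ordering, and this
keeps all prefix labels. -/
theorem reach_insert {K : Set (ZMod p)} {S : Multiset G} {v : ZMod q} (hv : v ∈ c.reach K S)
    {l : List G} (hl : c.label l = 0) {κ π : ZMod p} (hκ : κ ∈ K) (hπ : π ∈ c.prefixes l) :
    v + c.χ (κ - π) * c.β l.prod ∈ c.reach K (S + l) := by
  obtain ⟨m, rfl, hK, rfl⟩ := hv
  obtain ⟨a, b, rfl, ha⟩ := hK hκ
  obtain ⟨u, w, rfl, rfl⟩ := hπ
  have hl' : c.ℓ (u ++ w).prod = 0 := by rw [c.ℓ_prod, hl]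
  have hr0 : c.ℓ (w ++ u).prod = 0 := by
    rw [c.ℓ_prod, ← Multiset.coe_add, add_comm, Multiset.coe_add, hl]
  refine ⟨a ++ ((w ++ u) ++ b), ?_, ?_, ?_⟩
  · simp only [← Multiset.coe_add]; abel
  · intro k hk
    obtain ⟨s, t, hst, rfl⟩ := hK hk
    rcases List.append_eq_append_iff.1 hst with ⟨a', h1, h2⟩ | ⟨c', h1, h2⟩
    · refine ⟨a ++ ((w ++ u) ++ a'), t, by simp [h2], ?_⟩
      rw [h1]
      simp only [List.prod_append, c.ℓ_mul] at hr0 ⊢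
      rw [hr0, zero_add]
    · exact ⟨s, c' ++ ((w ++ u) ++ b), by simp [h1], rfl⟩
  · rw [List.prod_append, List.prod_append (l₁ := w ++ u), c.β_mul, c.β_mul, hr0, c.χ_zero,
      one_mul, c.β_rotate hl', List.prod_append (l₁ := a), c.β_mul, ha, sub_eq_add_neg, c.χ_add]
    ring

/-! ### Minimal label-zero sequences -/

/-- A piece is a nonempty sequence of total label zero without a proper such subsequence. -/
structure IsPiece (T : Multiset G) : Prop where
  ne_zero : T ≠ 0
  label_eq : c.label T = 0
  minimal : ∀ T' ≤ T, T' ≠ 0 → c.label T' = 0 → T' = T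

theorem isPiece_singleton {g : G} (hg : c.ℓ g = 0) : c.IsPiece {g} where
  ne_zero := by simp
  label_eq := by simpa using hg
  minimal T' h h0 _ := by
    rcases Multiset.le_singleton.1 h with h | h
    · exact absurd h h0
    · exact h

theorem exists_piece_le {R : Multiset G} (h0 : R ≠ 0) (h : c.label R = 0) :
    ∃ T ≤ R, c.IsPiece T := by
  induction R using Multiset.strongInductionOn with
  | ih R ih =>
    by_cases hR : ∀ T' ≤ R, T' ≠ 0 → c.label T' = 0 → T' = R
    · exact ⟨R, le_rfl, h0, h, hR⟩
    · push Not at hR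
      obtain ⟨T, h1, h2, h3, h4⟩ := hR
      obtain ⟨T', h5, h6⟩ := ih T (lt_of_le_of_ne h1 h4) h2 h3
      exact ⟨T', h5.trans h1, h6⟩

/-- A label-zero sequence is a sum of pieces. -/
theorem exists_pieces {R : Multiset G} (h : c.label R = 0) :
    ∃ Ts : Multiset (Multiset G), (∀ T ∈ Ts, c.IsPiece T) ∧ Ts.sum = R := by
  classical
  induction R using Multiset.strongInductionOn with
  | ih R ih =>
    by_cases h0 : R = 0
    · exact ⟨0, by simp, by simp [h0]⟩
    · obtain ⟨T, hT, hp⟩ := c.exists_piece_le h0 h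
      obtain ⟨Ts, h1, h2⟩ := ih (R - T) (by
        refine lt_of_le_of_ne (Multiset.sub_le_self _ _) fun he => hp.ne_zero ?_
        have := congrArg Multiset.card he
        rw [Multiset.card_sub hT] at this
        have h3 := Multiset.card_le_card hT
        have h4 := Multiset.card_pos.2 h0
        rw [← Multiset.card_eq_zero]; omega) (by
        rw [c.label_sub hT, h, hp.label_eq, sub_zero])
      refine ⟨T ::ₘ Ts, ?_, ?_⟩
      · intro T' hT'
        rcases Multiset.mem_cons.1 hT' with rfl | h
        · exact hp
        · exact h1 _ h
      · rw [Multiset.sum_cons, h2, add_comm, Multiset.sub_add_cancel hT]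

/-- The proper prefixes of an ordering of a piece have distinct labels. -/
theorem IsPiece.card_le_prefixes [NeZero p] {l : List G} (hl : c.IsPiece (l : Multiset G)) :
    l.length ≤ (c.prefixes l).ncard := by
  have hinj : Function.Injective fun i : Fin l.length => c.ℓ (l.take i).prod := by
    suffices h : ∀ i j : ℕ, i < j → j < l.length → c.ℓ (l.take i).prod ≠ c.ℓ (l.take j).prod by
      intro i j hij
      rcases lt_trichotomy i j with h1 | h1 | h1
      · exact absurd hij (h i j h1 j.2)
      · exact h1
      · exact absurd hij.symm (h j i h1 i.2)
    intro i j hij hj heq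
    -- the segment between the two prefixes would be a shorter label-zero subsequence
    have hspl : l.take j = l.take i ++ (l.take j).drop i := by
      conv_lhs => rw [← List.take_append_drop i (l.take j)]
      rw [List.take_take, min_eq_left hij.le]
    have hlen : ((l.take j).drop i).length = j - i := by simp; omega
    have hz : c.label ((l.take j).drop i : List G) = 0 := by
      have h1 := heq
      rw [hspl, List.prod_append, c.ℓ_mul, c.ℓ_prod ((l.take j).drop i)] at h1
      simpa using h1
    have hsub : ((l.take j).drop i).Sublist l :=
      (List.drop_sublist _ _).trans (List.take_sublist _ _)
    have h2 := hl.minimal _ (Multiset.coe_le.2 hsub.subperm) (by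
      intro h0
      have := congrArg Multiset.card h0
      simp at this; omega) hz
    have h3 := congrArg Multiset.card h2
    rw [Multiset.coe_card, Multiset.coe_card, hlen] at h3
    omega
  have hsub : Set.range (fun i : Fin l.length => c.ℓ (l.take i).prod) ⊆ c.prefixes l := by
    rintro _ ⟨i, rfl⟩
    exact ⟨l.take i, l.drop i, (List.take_append_drop _ _).symm, rfl⟩
  have := Set.ncard_le_ncard hsub (Set.toFinite _)
  rwa [← Set.image_univ, Set.ncard_image_of_injective _ hinj, Set.ncard_univ, Nat.card_fin] at this

theorem IsPiece.card_le [NeZero p] {T : Multiset G} (hT : c.IsPiece T) : T.card ≤ p := by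
  induction T using Quotient.inductionOn with
  | h l =>
    have h1 := IsPiece.card_le_prefixes c (l := l) hT
    have h2 := Set.ncard_le_card (c.prefixes l)
    rw [Nat.card_zmod] at h2
    exact h1.trans h2

theorem IsPiece.two_le_card {T : Multiset G} (hT : c.IsPiece T) {g : G}
    (hg : g ∈ T) (h0 : c.ℓ g ≠ 0) : 2 ≤ T.card := by
  by_contra h
  have h1 := Multiset.card_pos.2 hT.ne_zero
  have : T.card = 1 := by omega
  obtain ⟨a, rfl⟩ := Multiset.card_eq_one.1 this
  rw [Multiset.mem_singleton] at hg
  subst hg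
  exact h0 (by simpa using hT.label_eq)

theorem χ_ne_zero [Fact q.Prime] (a : ZMod p) : c.χ a ≠ 0 := by
  intro h
  have := c.χ_neg_mul a
  rw [h, mul_zero] at this
  exact zero_ne_one this

/-- The values by which inserting a piece into an ordering with prefix labels `K` can change the
translation part. -/
theorem insertions_card [Fact p.Prime] [Fact q.Prime] {l : List G} (hl : c.IsPiece (l : Multiset G))
    (h0 : c.β l.prod ≠ 0) {K : Set (ZMod p)} (hK : K.Nonempty) :
    min p (K.ncard + l.length - 1) ≤
      {v | ∃ κ ∈ K, ∃ π ∈ c.prefixes l, v = c.χ (κ - π) * c.β l.prod}.ncard := by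
  have hk : 0 < K.ncard := (Set.ncard_pos (Set.toFinite _)).2 hK
  have hp := IsPiece.card_le_prefixes c hl
  have hl0 : 0 < l.length := by
    have := Multiset.card_pos.2 hl.ne_zero
    simpa using this
  have hneg : ((fun a => -a) '' c.prefixes l).ncard = (c.prefixes l).ncard :=
    Set.ncard_image_of_injective _ neg_injective
  have h1 := cauchyDavenport_step (A := K) (B := (fun a => -a) '' c.prefixes l)
    (C := {d | ∃ κ ∈ K, ∃ π ∈ c.prefixes l, d = κ - π}) (x := K.ncard - 1)
    (y := (c.prefixes l).ncard - 1) (by rw [Nat.sub_add_cancel hk]; exact min_le_right _ _)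
    (by rw [hneg]; omega) (by
      rintro a ha _ ⟨b, hb, rfl⟩
      exact ⟨a, ha, b, hb, (sub_eq_add_neg a b).symm⟩)
  have hinj : Function.Injective fun d => c.χ d * c.β l.prod := by
    intro a b hab
    exact c.χ_inj (mul_right_cancel₀ h0 hab)
  have h2 : {v | ∃ κ ∈ K, ∃ π ∈ c.prefixes l, v = c.χ (κ - π) * c.β l.prod} =
      (fun d => c.χ d * c.β l.prod) '' {d | ∃ κ ∈ K, ∃ π ∈ c.prefixes l, d = κ - π} := by
    ext v
    constructor
    · rintro ⟨κ, h1, π, h2, rfl⟩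
      exact ⟨_, ⟨κ, h1, π, h2, rfl⟩, rfl⟩
    · rintro ⟨_, ⟨κ, h1, π, h2, rfl⟩, rfl⟩
      exact ⟨κ, h1, π, h2, rfl⟩
  rw [h2, Set.ncard_image_of_injective _ hinj]
  omega

/-! ### Growth under insertion of pieces -/

/-- Inserting pieces into orderings with prefix labels `K`: each piece adds to the Cauchy–Davenport
bound one less than the number of shifts given by `insertions_card`. -/
theorem reach_card [Fact p.Prime] [Fact q.Prime] {K : Set (ZMod p)} (hK : K.Nonempty)
    {S : Multiset G} {x : ℕ} (hS : min q (x + 1) ≤ (c.reach K S).ncard)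
    (Ts : Multiset (Multiset G)) (hp : ∀ T ∈ Ts, c.IsPiece T)
    (h0 : ∀ T ∈ Ts, (0 : ZMod q) ∉ c.vals T) :
    min q (x + (Ts.map fun T => min p (K.ncard + T.card - 1) - 1).sum + 1) ≤
      (c.reach K (S + Ts.sum)).ncard := by
  have hk : 0 < K.ncard := (Set.ncard_pos (Set.toFinite _)).2 hK
  have hp0 : 0 < p := (Fact.out : p.Prime).pos
  induction Ts using Multiset.induction with
  | empty => simpa using hS
  | cons T Ts ih =>
    have ih' := ih (fun T h => hp T (Multiset.mem_cons_of_mem h))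
      (fun T h => h0 T (Multiset.mem_cons_of_mem h))
    have hT := hp T (Multiset.mem_cons_self _ _)
    have hT0 := h0 T (Multiset.mem_cons_self _ _)
    induction T using Quotient.inductionOn with
    | h l =>
      change c.IsPiece (l : Multiset G) at hT
      have hb : c.β l.prod ≠ 0 := fun h => hT0 ⟨l, rfl, h⟩
      have hl0 := Multiset.card_pos.2 hT.ne_zero
      rw [Multiset.coe_card] at hl0
      have h1 := c.insertions_card hT hb hK
      set D := {v | ∃ κ ∈ K, ∃ π ∈ c.prefixes l, v = c.χ (κ - π) * c.β l.prod} with hD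
      have h2 := cauchyDavenport_step (C := c.reach K (S + Ts.sum + l)) (B := D) ih'
        (y := min p (K.ncard + l.length - 1) - 1) (by omega) (by
          rintro v hv _ ⟨κ, hκ, π, hπ, rfl⟩
          exact c.reach_insert hv hT.label_eq hκ hπ)
      have h3 : S + (Multiset.sum ((l : Multiset G) ::ₘ Ts)) = S + Ts.sum + l := by
        rw [Multiset.sum_cons]; abel
      change _ ≤ (c.reach K (S + (Multiset.sum ((l : Multiset G) ::ₘ Ts)))).ncard
      rw [h3]
      refine le_trans (le_of_eq ?_) h2
      change min q (x + (Multiset.map _ ((l : Multiset G) ::ₘ Ts)).sum + 1) = _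
      rw [Multiset.map_cons, Multiset.sum_cons, Multiset.coe_card]
      congr 1
      omega

/-- The values reached by adjoining to some member of a family of sequences a label-zero
subsequence of `W`. -/
def subreach (K : Set (ZMod p)) (F : Set (Multiset G)) (W : Multiset G) : Set (ZMod q) :=
  {v | ∃ U ∈ F, ∃ W' ≤ W, c.label W' = 0 ∧ v ∈ c.reach K (U + W')}

/-- Inserting any selection of pieces: since a piece may also be left out, the shift `0` is available
as well, and each piece adds the full number of shifts given by `insertions_card`. -/
theorem subreach_card [Fact p.Prime] [Fact q.Prime] {K : Set (ZMod p)} (hK : K.Nonempty)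
    {F : Set (Multiset G)} {x : ℕ} (hS : min q (x + 1) ≤ (c.subreach K F 0).ncard)
    (Ts : Multiset (Multiset G)) (hp : ∀ T ∈ Ts, c.IsPiece T)
    (h0 : ∀ T ∈ Ts, (0 : ZMod q) ∉ c.vals T) :
    min q (x + (Ts.map fun T => min p (K.ncard + T.card - 1)).sum + 1) ≤
      (c.subreach K F Ts.sum).ncard := by
  have hk : 0 < K.ncard := (Set.ncard_pos (Set.toFinite _)).2 hK
  have hp0 : 0 < p := (Fact.out : p.Prime).pos
  induction Ts using Multiset.induction with
  | empty => simpa using hS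
  | cons T Ts ih =>
    have ih' := ih (fun T h => hp T (Multiset.mem_cons_of_mem h))
      (fun T h => h0 T (Multiset.mem_cons_of_mem h))
    have hT := hp T (Multiset.mem_cons_self _ _)
    have hT0 := h0 T (Multiset.mem_cons_self _ _)
    induction T using Quotient.inductionOn with
    | h l =>
      change c.IsPiece (l : Multiset G) at hT
      have hb : c.β l.prod ≠ 0 := fun h => hT0 ⟨l, rfl, h⟩
      have h1 := c.insertions_card hT hb hK
      set D := {v | ∃ κ ∈ K, ∃ π ∈ c.prefixes l, v = c.χ (κ - π) * c.β l.prod} with hD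
      have hD0 : (0 : ZMod q) ∉ D := by
        rintro ⟨κ, _, π, _, h⟩
        exact mul_ne_zero (c.χ_ne_zero _) hb h.symm
      have hD1 : min p (K.ncard + l.length - 1) + 1 ≤ (insert 0 D).ncard := by
        rw [Set.ncard_insert_of_notMem hD0 (Set.toFinite _)]; omega
      have h2 := cauchyDavenport_step (C := c.subreach K F (Ts.sum + l)) ih' hD1 (by
          rintro v ⟨U, hU, W', hW', hl', hv⟩ d (rfl | ⟨κ, hκ, π, hπ, rfl⟩)
          · exact ⟨U, hU, W', hW'.trans (Multiset.le_add_right _ _), hl', by simpa using hv⟩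
          · refine ⟨U, hU, W' + l, by gcongr, by rw [c.label_add, hl', hT.label_eq, add_zero], ?_⟩
            rw [← add_assoc]
            exact c.reach_insert hv hT.label_eq hκ hπ)
      change _ ≤ (c.subreach K F (Multiset.sum ((l : Multiset G) ::ₘ Ts))).ncard
      rw [Multiset.sum_cons, add_comm (l : Multiset G)]
      refine le_trans (le_of_eq ?_) h2
      change min q (x + (Multiset.map _ ((l : Multiset G) ::ₘ Ts)).sum + 1) = _
      rw [Multiset.map_cons, Multiset.sum_cons, Multiset.coe_card]
      congr 1
      omega

/-! ### Sets invariant under the character values -/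

/-- A set of translation parts stable under multiplication by all values of the character. -/
def IsInvariant (Z : Set (ZMod q)) : Prop := ∀ κ, ∀ z ∈ Z, c.χ κ * z ∈ Z

theorem orbit_ncard [NeZero p] [Fact q.Prime] {a : ZMod q} (ha : a ≠ 0) :
    (Set.range fun κ => c.χ κ * a).ncard = p := by
  rw [← Set.image_univ, Set.ncard_image_of_injective, Set.ncard_univ, Nat.card_zmod]
  intro x y hxy
  exact c.χ_inj (mul_right_cancel₀ ha hxy)

/-- An invariant set consists of orbits of size `p` and possibly the point `0`. -/
theorem IsInvariant.ncard [NeZero p] [Fact q.Prime] {Z : Set (ZMod q)} (hZ : c.IsInvariant Z) :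
    (0 ∉ Z → ∃ a, Z.ncard = a * p) ∧ (0 ∈ Z → ∃ a, Z.ncard = a * p + 1) := by
  have key : ∀ n : ℕ, ∀ Z : Set (ZMod q), Z.ncard = n → c.IsInvariant Z → 0 ∉ Z →
      ∃ a, Z.ncard = a * p := by
    intro n
    induction n using Nat.strong_induction_on with
    | _ n ih =>
      intro Z hn hZ h0
      rcases Z.eq_empty_or_nonempty with rfl | ⟨a, ha⟩
      · exact ⟨0, by simp⟩
      · have ha0 : a ≠ 0 := fun h => h0 (h ▸ ha)
        have hsub : (Set.range fun κ => c.χ κ * a) ⊆ Z := by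
          rintro _ ⟨κ, rfl⟩; exact hZ κ a ha
        have h1 := Set.ncard_sdiff_add_ncard_of_subset hsub (Set.toFinite _)
        rw [c.orbit_ncard ha0] at h1
        have hp : 0 < p := Nat.pos_of_ne_zero (NeZero.ne p)
        obtain ⟨b, hb⟩ := ih (Z \ Set.range fun κ => c.χ κ * a).ncard (by omega) _ rfl (by
          rintro κ z ⟨hz, hz'⟩
          refine ⟨hZ κ z hz, ?_⟩
          rintro ⟨μ, hμ⟩
          apply hz'
          refine ⟨-κ + μ, ?_⟩
          change c.χ μ * a = c.χ κ * z at hμ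
          change c.χ (-κ + μ) * a = z
          rw [c.χ_add, mul_assoc, hμ, ← mul_assoc, c.χ_neg_mul, one_mul]) (fun h => h0 h.1)
        exact ⟨b + 1, by rw [← h1, hb, add_mul, one_mul]⟩
  refine ⟨key _ Z rfl hZ, fun h0 => ?_⟩
  obtain ⟨a, ha⟩ := key _ (Z \ {0}) rfl (by
    rintro κ z ⟨hz, hz'⟩
    exact ⟨hZ κ z hz, mul_ne_zero (c.χ_ne_zero κ) hz'⟩) (by simp)
  refine ⟨a, ?_⟩
  rw [← Set.ncard_sdiff_singleton_add_one h0 (Set.toFinite _), ha]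

theorem IsInvariant.mem_of_ne_zero [NeZero p] [Fact q.Prime] (hp : 2 ≤ p) {Z : Set (ZMod q)}
    (hZ : c.IsInvariant Z) (hcard : q - 1 ≤ Z.ncard) {z : ZMod q} (hz : z ≠ 0) : z ∈ Z := by
  by_contra hzZ
  have hdisj : Disjoint Z (Set.range fun κ => c.χ κ * z) := by
    rw [Set.disjoint_right]
    rintro _ ⟨κ, rfl⟩ h
    have := hZ (-κ) _ h
    rw [← mul_assoc, c.χ_neg_mul, one_mul] at this
    exact hzZ this
  have h1 := Set.ncard_union_eq hdisj (Set.toFinite _) (Set.toFinite _)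
  rw [c.orbit_ncard hz] at h1
  have h2 := Set.ncard_le_card (Z ∪ Set.range fun κ => c.χ κ * z)
  rw [Nat.card_zmod] at h2
  have := (Fact.out : q.Prime).two_le
  omega

/-- When every piece has enough prefix labels to be inserted with all rotations, each further
piece contributes a full orbit: the invariance rounds the Cauchy–Davenport bound up. -/
theorem reach_orbits [Fact p.Prime] [Fact q.Prime] (hp3 : 3 ≤ p) {M : ℕ} (hq : q = M * p + 1)
    {K : Set (ZMod p)} (hK : K.Nonempty)
    {S : Multiset G} {v : ZMod q} (hv : v ∈ c.reach K S)
    (Ts : Multiset (Multiset G)) (hp : ∀ T ∈ Ts, c.IsPiece T)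
    (h0 : ∀ T ∈ Ts, (0 : ZMod q) ∉ c.vals T) (hall : ∀ T ∈ Ts, p + 1 ≤ K.ncard + T.card) :
    ∃ Z : Set (ZMod q), c.IsInvariant Z ∧ (∀ z ∈ Z, v + z ∈ c.reach K (S + Ts.sum)) ∧
      Z.Nonempty ∧ min (M * p) (Ts.card * p) ≤ Z.ncard := by
  induction Ts using Multiset.induction with
  | empty =>
    exact ⟨{0}, by rintro κ z rfl; simp, by rintro z rfl; simpa using hv, by simp, by simp⟩
  | cons T Ts ih =>
    obtain ⟨Z, hZ, hZv, hZ0, hZc⟩ := ih (fun T h => hp T (Multiset.mem_cons_of_mem h))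
      (fun T h => h0 T (Multiset.mem_cons_of_mem h))
      (fun T h => hall T (Multiset.mem_cons_of_mem h))
    have hT := hp T (Multiset.mem_cons_self _ _)
    have hT0 := h0 T (Multiset.mem_cons_self _ _)
    have hTc := hall T (Multiset.mem_cons_self _ _)
    obtain ⟨l, rfl⟩ : ∃ l : List G, (l : Multiset G) = T := ⟨T.toList, by simp⟩
    have hb : c.β l.prod ≠ 0 := fun h => hT0 ⟨l, rfl, h⟩
    rw [Multiset.coe_card] at hTc
    have h1 := c.insertions_card hT hb hK
    have hD : ∀ κ, ∃ κ' ∈ K, ∃ π ∈ c.prefixes l, c.χ κ * c.β l.prod = c.χ (κ' - π) * c.β l.prod := by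
      intro κ
      have hsub : {v | ∃ κ ∈ K, ∃ π ∈ c.prefixes l, v = c.χ (κ - π) * c.β l.prod} ⊆
          Set.range fun κ => c.χ κ * c.β l.prod := by
        rintro _ ⟨κ, _, π, _, rfl⟩
        exact ⟨_, rfl⟩
      have heq := Set.eq_of_subset_of_ncard_le hsub (by rw [c.orbit_ncard hb]; omega)
      have hm : c.χ κ * c.β l.prod ∈ Set.range fun κ => c.χ κ * c.β l.prod := ⟨κ, rfl⟩
      rw [← heq] at hm
      exact hm
    have hZ1 : 0 < Z.ncard := (Set.ncard_pos (Set.toFinite _)).2 hZ0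
    set Z' : Set (ZMod q) := {w | ∃ z ∈ Z, ∃ κ, w = z + c.χ κ * c.β l.prod} with hZ'
    have hinv : c.IsInvariant Z' := by
      rintro μ _ ⟨z, hz, κ, rfl⟩
      exact ⟨c.χ μ * z, hZ μ z hz, μ + κ, by rw [c.χ_add]; ring⟩
    have hcd := cauchyDavenport_step (A := Z) (B := Set.range fun κ => c.χ κ * c.β l.prod)
      (C := Z') (x := Z.ncard - 1) (y := p - 1)
      (by rw [Nat.sub_add_cancel hZ1]; exact min_le_right _ _)
      (by rw [c.orbit_ncard hb]; omega)
      (by rintro z hz _ ⟨κ, rfl⟩; exact ⟨z, hz, κ, rfl⟩)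
    refine ⟨Z', hinv, ?_, ?_, ?_⟩
    · rintro _ ⟨z, hz, κ, rfl⟩
      obtain ⟨κ', hκ', π, hπ, h⟩ := hD κ
      have := c.reach_insert (hZv z hz) hT.label_eq hκ' hπ
      rw [← h] at this
      rw [Multiset.sum_cons, add_comm (l : Multiset G), ← add_assoc, ← add_assoc]
      exact this
    · obtain ⟨z, hz⟩ := hZ0
      exact ⟨_, z, hz, 0, rfl⟩
    · rw [Multiset.card_cons]
      have hmod := IsInvariant.ncard c hinv
      rcases le_total M Ts.card with hM | hM
      · have : M * p ≤ Ts.card * p := Nat.mul_le_mul_right p hM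
        have : M * p ≤ (Ts.card + 1) * p := Nat.mul_le_mul_right p (by omega)
        omega
      · have h2 : Ts.card * p ≤ M * p := Nat.mul_le_mul_right p hM
        rw [min_eq_right h2] at hZc
        by_cases hqc : q ≤ Z.ncard - 1 + (p - 1) + 1
        · have : M * p ≤ Z'.ncard := by omega
          omega
        · have h3 : Ts.card * p + p - 1 ≤ Z'.ncard := by omega
          refine min_le_of_right_le ?_
          rw [add_mul, one_mul]
          have h4 : ∀ a, Ts.card * p + p - 2 ≤ a * p → (Ts.card + 1) * p ≤ a * p := by
            intro a ha
            apply Nat.mul_le_mul_right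
            by_contra hlt
            have : a * p ≤ Ts.card * p := Nat.mul_le_mul_right p (by omega)
            omega
          by_cases hz : (0 : ZMod q) ∈ Z'
          · obtain ⟨a, ha⟩ := hmod.2 hz
            have := h4 a (by omega)
            rw [add_mul, one_mul] at this
            omega
          · obtain ⟨a, ha⟩ := hmod.1 hz
            have := h4 a (by omega)
            rw [add_mul, one_mul] at this
            omega

/-- A label-zero sequence of length at least `q + 1`, not contained in the normal subgroup of
order `q` and without short product-one subsequences, is product-one. -/
theorem zero_mem_vals_of_long [Fact p.Prime] [Fact q.Prime] (hp3 : 3 ≤ p) {M : ℕ}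
    (hq : q = M * p + 1) {R : Multiset G} (hR : c.label R = 0) (hcard : q + 1 ≤ R.card)
    (hnon : ∃ g ∈ R, c.ℓ g ≠ 0)
    (hshort : ∀ T ≤ R, T ≠ 0 → T.card ≤ p → c.label T = 0 → (0 : ZMod q) ∉ c.vals T) :
    (0 : ZMod q) ∈ c.vals R := by
  classical
  obtain ⟨Ts, hTs, rfl⟩ := c.exists_pieces hR
  have hle : ∀ T ∈ Ts, T ≤ Ts.sum := fun T hT => Multiset.single_le_sum (by simp) T hT
  have h0 : ∀ T ∈ Ts, (0 : ZMod q) ∉ c.vals T := fun T hT =>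
    hshort T (hle T hT) (hTs T hT).ne_zero (IsPiece.card_le c (hTs T hT)) (hTs T hT).label_eq
  -- a piece of length `p`, if there is one, is the best ordering to insert the others into
  have hT1 : ∃ T₁ ∈ Ts, 2 ≤ T₁.card ∧ ((∃ T ∈ Ts, T.card = p) → T₁.card = p) := by
    by_cases hex : ∃ T ∈ Ts, T.card = p
    · obtain ⟨T, hT, hTp⟩ := hex
      exact ⟨T, hT, by omega, fun _ => hTp⟩
    · obtain ⟨g, hg, hg0⟩ := hnon
      obtain ⟨T, hT, hgT⟩ := Multiset.mem_join.1 hg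
      exact ⟨T, hT, IsPiece.two_le_card c (hTs T hT) hgT hg0, fun h => absurd h hex⟩
  obtain ⟨T₁, hT₁, h2, hmax⟩ := hT1
  obtain ⟨Ts, rfl⟩ := Multiset.exists_cons_of_mem hT₁
  obtain ⟨l, rfl⟩ : ∃ l : List G, (l : Multiset G) = T₁ := ⟨T₁.toList, by simp⟩
  have hpl := hTs _ hT₁
  have hK := IsPiece.card_le_prefixes c hpl
  have hK0 : (c.prefixes l).Nonempty := ⟨0, c.zero_mem_prefixes l⟩
  have hb : c.β l.prod ≠ 0 := fun h => h0 _ hT₁ ⟨l, rfl, h⟩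
  have hbase : c.β l.prod ∈ c.reach (c.prefixes l) (l : Multiset G) := ⟨l, rfl, subset_rfl, rfl⟩
  rw [Multiset.coe_card] at h2 hmax
  rw [Multiset.sum_cons, Multiset.card_add, Multiset.coe_card] at hcard
  have hsumcard : Ts.sum.card = (Ts.map Multiset.card).sum := by
    simpa using map_multiset_sum (Multiset.cardHom : Multiset G →+ ℕ) Ts
  have hTs' : ∀ T ∈ Ts, c.IsPiece T := fun T h => hTs T (Multiset.mem_cons_of_mem h)
  have h0' : ∀ T ∈ Ts, (0 : ZMod q) ∉ c.vals T := fun T h => h0 T (Multiset.mem_cons_of_mem h)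
  rw [Multiset.sum_cons]
  apply c.reach_subset_vals (c.prefixes l)
  by_cases hall : ∀ T ∈ Ts, p + 1 ≤ (c.prefixes l).ncard + T.card
  · obtain ⟨Z, hZ, hZv, hZ0, hZc⟩ := c.reach_orbits hp3 hq hK0 hbase Ts hTs' h0' hall
    have hlp := IsPiece.card_le c hpl
    rw [Multiset.coe_card] at hlp
    have hc1 : (Ts.map Multiset.card).sum ≤ Ts.card * p := by
      have := Multiset.sum_le_card_nsmul (Ts.map Multiset.card) p (by
        intro x hx
        obtain ⟨T, hT, rfl⟩ := Multiset.mem_map.1 hx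
        exact IsPiece.card_le c (hTs' T hT))
      simpa using this
    have hMc : M ≤ Ts.card := by
      by_contra hlt
      have : (Ts.card + 1) * p ≤ M * p := Nat.mul_le_mul_right p (by omega)
      rw [add_mul, one_mul] at this
      omega
    have : M * p ≤ Ts.card * p := Nat.mul_le_mul_right p hMc
    have hz := IsInvariant.mem_of_ne_zero c (by omega) hZ (by omega)
      (neg_ne_zero.2 hb)
    simpa using hZv _ hz
  · push Not at hall
    obtain ⟨T₂, hT₂, hlt⟩ := hall
    have hnp : ∀ T ∈ Ts, T.card + 1 ≤ p := by
      intro T hT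
      have h3 := IsPiece.card_le c (hTs' T hT)
      by_contra h4
      have := hmax ⟨T, Multiset.mem_cons_of_mem hT, by omega⟩
      have := Multiset.card_pos.2 (hTs' T₂ hT₂).ne_zero
      omega
    have hr := c.reach_card hK0 (S := (l : Multiset G)) (x := 0) (by
      refine min_le_of_right_le ?_
      rw [zero_add, Nat.one_le_iff_ne_zero, ← Nat.pos_iff_ne_zero, Set.ncard_pos (Set.toFinite _)]
      exact ⟨_, hbase⟩) Ts hTs' h0'
    refine mem_of_min_le_ncard hr ?_ 0
    obtain ⟨Ts, rfl⟩ := Multiset.exists_cons_of_mem hT₂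
    have hsum : (Ts.map Multiset.card).sum ≤
        (Ts.map fun T => min p ((c.prefixes l).ncard + T.card - 1) - 1).sum := by
      apply Multiset.sum_map_le_sum_map
      intro T hT
      have := hnp T (Multiset.mem_cons_of_mem hT)
      have := Multiset.card_pos.2 (hTs' T (Multiset.mem_cons_of_mem hT)).ne_zero
      omega
    rw [hsumcard, Multiset.map_cons, Multiset.sum_cons] at hcard
    rw [Multiset.map_cons, Multiset.sum_cons]
    have := Multiset.card_pos.2 (hTs' T₂ hT₂).ne_zero
    omega

end AffineCoord

/-! ### Splitting minimal product-one sequences -/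

theorem IsMinimalProductOne.one_notMem {G : Type*} [Group G] {S : Multiset G}
    (hS : IsMinimalProductOne S) (hcard : 2 ≤ S.card) : (1 : G) ∉ S := by
  intro h1
  obtain ⟨⟨l, rfl, hl⟩, hmin⟩ := hS
  rw [Multiset.mem_coe] at h1
  obtain ⟨a, b, rfl⟩ := List.append_of_mem h1
  refine hmin {1} ((a ++ b : List G) : Multiset G) (by simp) ?_ ⟨[1], by simp, by simp⟩
    ⟨a ++ b, rfl, by simpa using hl⟩ ?_
  · intro h
    have := congrArg Multiset.card h
    simp at this hcard
    simp [this] at hcard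
  · simp only [← Multiset.coe_add, ← Multiset.cons_coe, ← Multiset.singleton_add]; abel

namespace AffineCoord

variable {p q : ℕ} {G : Type*} [Group G] (c : AffineCoord p q G)

theorem not_split [DecidableEq G] {S U : Multiset G} (hS : IsMinimalProductOne S) (hU : U ≤ S)
    (h0 : U ≠ 0) (hne : U.card < S.card) (hl : c.label U = 0) (hv : (0 : ZMod q) ∈ c.vals U)
    (hR : (0 : ZMod q) ∈ c.vals (S - U)) : False := by
  refine hS.2 U (S - U) h0 ?_ ((c.isProductOne_iff U).2 ⟨hl, hv⟩)
    ((c.isProductOne_iff _).2 ⟨?_, hR⟩) (by rw [add_comm, Multiset.sub_add_cancel hU])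
  · intro h
    have := congrArg Multiset.card h
    rw [Multiset.card_sub hU] at this
    simp at this
    omega
  · rw [c.label_sub hU, hl, ((c.isProductOne_iff S).1 hS.1).1, sub_zero]

theorem vals_of_label_zero {S : Multiset G} (h : ∀ g ∈ S, c.ℓ g = 0) :
    c.vals S = {(S.map c.β).sum} := by
  have key : ∀ l : List G, (∀ g ∈ l, c.ℓ g = 0) → c.β l.prod = (l.map c.β).sum := by
    intro l
    induction l with
    | nil => simp [c.β_one]
    | cons g l ih =>
      intro h
      rw [List.prod_cons, c.β_mul, h g List.mem_cons_self, c.χ_zero, one_mul,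
        ih fun a ha => h a (List.mem_cons_of_mem _ ha)]
      simp
  ext v
  constructor
  · rintro ⟨l, rfl, rfl⟩
    rw [Set.mem_singleton_iff, key l (by simpa using h)]
    simp
  · rintro rfl
    refine ⟨S.toList, by simp, ?_⟩
    rw [key _ (by simpa using h)]
    conv_rhs => rw [← S.coe_toList]
    simp

theorem label_of_label_zero {S : Multiset G} (h : ∀ g ∈ S, c.ℓ g = 0) : c.label S = 0 := by
  rw [label, Multiset.map_congr rfl h]; simp

theorem reach_normal [Fact p.Prime] [Fact q.Prime] {K : Set (ZMod p)} (hK : K.Nonempty)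
    {S : Multiset G} {x : ℕ} (hS : min q (x + 1) ≤ (c.reach K S).ncard)
    {Y : Multiset G} (hY : ∀ y ∈ Y, c.ℓ y = 0) (hb : ∀ y ∈ Y, c.β y ≠ 0) :
    min q (x + Y.card * (K.ncard - 1) + 1) ≤ (c.reach K (S + Y)).ncard := by
  have h1 := c.reach_card hK hS (Y.map fun y => {y})
    (by
      intro T hT
      obtain ⟨y, hy, rfl⟩ := Multiset.mem_map.1 hT
      exact c.isPiece_singleton (hY y hy))
    (by
      intro T hT
      obtain ⟨y, hy, rfl⟩ := Multiset.mem_map.1 hT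
      rw [c.vals_of_label_zero (by simpa using hY y hy)]
      simpa [eq_comm] using hb y hy)
  have hKp : K.ncard ≤ p := by simpa using Set.ncard_le_card K
  simpa [Multiset.sum_map_singleton, min_eq_right hKp] using h1

theorem subreach_normal [Fact p.Prime] [Fact q.Prime] {K : Set (ZMod p)} (hK : K.Nonempty)
    {F : Set (Multiset G)} {x : ℕ} (hS : min q (x + 1) ≤ (c.subreach K F 0).ncard)
    {Y : Multiset G} (hY : ∀ y ∈ Y, c.ℓ y = 0) (hb : ∀ y ∈ Y, c.β y ≠ 0) :
    min q (x + Y.card * K.ncard + 1) ≤ (c.subreach K F Y).ncard := by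
  have h1 := c.subreach_card hK hS (Y.map fun y => {y})
    (by
      intro T hT
      obtain ⟨y, hy, rfl⟩ := Multiset.mem_map.1 hT
      exact c.isPiece_singleton (hY y hy))
    (by
      intro T hT
      obtain ⟨y, hy, rfl⟩ := Multiset.mem_map.1 hT
      rw [c.vals_of_label_zero (by simpa using hY y hy)]
      simpa [eq_comm] using hb y hy)
  have hKp : K.ncard ≤ p := by simpa using Set.ncard_le_card K
  simpa [Multiset.sum_map_singleton, min_eq_right hKp] using h1

/-- An ordering reaches at least one value with its own prefix labels. -/
theorem one_le_reach [NeZero q] (l : List G) :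
    min q (0 + 1) ≤ (c.reach (c.prefixes l) (l : Multiset G)).ncard := by
  refine min_le_of_right_le ?_
  rw [zero_add, Nat.one_le_iff_ne_zero, ← Nat.pos_iff_ne_zero, Set.ncard_pos (Set.toFinite _)]
  exact ⟨_, l, rfl, subset_rfl, rfl⟩

theorem one_le_subreach [NeZero q] (l : List G) :
    min q (0 + 1) ≤ (c.subreach (c.prefixes l) {(l : Multiset G)} 0).ncard := by
  refine min_le_of_right_le ?_
  rw [zero_add, Nat.one_le_iff_ne_zero, ← Nat.pos_iff_ne_zero, Set.ncard_pos (Set.toFinite _)]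
  exact ⟨_, _, rfl, 0, le_rfl, by simp, l, by simp, subset_rfl, rfl⟩

theorem two_le_prefixes [NeZero p] {X : Multiset G} (hX0 : X ≠ 0) (hX : ∀ g ∈ X, c.ℓ g ≠ 0) :
    ∃ l : List G, (l : Multiset G) = X ∧ 2 ≤ (c.prefixes l).ncard := by
  obtain ⟨g, hg⟩ := Multiset.exists_mem_of_ne_zero hX0
  obtain ⟨X, rfl⟩ := Multiset.exists_cons_of_mem hg
  refine ⟨g :: X.toList, by simp [← Multiset.cons_coe], ?_⟩
  have hsub : {0, c.ℓ g} ⊆ c.prefixes (g :: X.toList) := by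
    rintro κ (rfl | rfl)
    · exact c.zero_mem_prefixes _
    · exact ⟨[g], X.toList, rfl, by simp⟩
  have := Set.ncard_le_ncard hsub (Set.toFinite _)
  rwa [Set.ncard_pair (hX g hg).symm] at this

/-- A sequence with many terms in the normal subgroup and a nontrivial term outside it attains
every value. -/
theorem mem_vals_of_normal [Fact p.Prime] [Fact q.Prime] {X Y : Multiset G} (hX0 : X ≠ 0)
    (hX : ∀ g ∈ X, c.ℓ g ≠ 0) (hY : ∀ y ∈ Y, c.ℓ y = 0) (hb : ∀ y ∈ Y, c.β y ≠ 0)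
    (hcard : q ≤ Y.card + 1) (v : ZMod q) : v ∈ c.vals (X + Y) := by
  obtain ⟨l, rfl, h2⟩ := c.two_le_prefixes hX0 hX
  apply c.reach_subset_vals (c.prefixes l)
  refine mem_of_min_le_ncard (c.reach_normal ⟨0, c.zero_mem_prefixes l⟩ (c.one_le_reach l) hY hb)
    ?_ v
  have : Y.card * 1 ≤ Y.card * ((c.prefixes l).ncard - 1) := Nat.mul_le_mul_left _ (by omega)
  omega

/-- A nonempty sequence outside the normal subgroup attains the value `0` when a suitable selection
from `(q - 1) / 2` terms of the normal subgroup is adjoined. -/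
theorem exists_zero_mem_vals_of_normal [Fact p.Prime] [Fact q.Prime] {T Y : Multiset G} (hT0 : T ≠ 0)
    (hT : ∀ g ∈ T, c.ℓ g ≠ 0) (hY : ∀ y ∈ Y, c.ℓ y = 0) (hb : ∀ y ∈ Y, c.β y ≠ 0)
    (hcard : q ≤ 2 * Y.card + 1) :
    ∃ W ≤ Y, (0 : ZMod q) ∈ c.vals (T + W) := by
  obtain ⟨l, rfl, h2⟩ := c.two_le_prefixes hT0 hT
  have h := mem_of_min_le_ncard
    (c.subreach_normal ⟨0, c.zero_mem_prefixes l⟩ (c.one_le_subreach l) hY hb)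
    (by
      have : Y.card * 2 ≤ Y.card * (c.prefixes l).ncard := Nat.mul_le_mul_left _ h2
      omega) 0
  obtain ⟨U, rfl, W, hW, -, hv⟩ := h
  exact ⟨W, hW, c.reach_subset_vals _ _ hv⟩

theorem exists_zero_sum_normal [Fact q.Prime] {Y : Multiset G} (hY : ∀ y ∈ Y, c.ℓ y = 0)
    (hcard : q ≤ Y.card) :
    ∃ U ≤ Y, U ≠ 0 ∧ U.card ≤ q ∧ (0 : ZMod q) ∈ c.vals U := by
  obtain ⟨Y', hY', hc⟩ := Multiset.exists_le_card_eq hcard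
  have hsum : ((Y'.map fun y => ({y} : Multiset G)).toList).sum = Y' := by
    rw [← Multiset.sum_coe, Multiset.coe_toList, Multiset.sum_map_singleton]
  obtain ⟨U, h0, hU, hUc, hUs⟩ := exists_zero_sum_selection c.β
    ((Y'.map fun y => ({y} : Multiset G)).toList)
    (by
      intro B hB
      rw [Multiset.mem_toList, Multiset.mem_map] at hB
      obtain ⟨y, -, rfl⟩ := hB
      simp)
    (by rw [hsum, hc])
  rw [hsum] at hU
  refine ⟨U, hU.trans hY', h0, by simpa [hc] using hUc, ?_⟩
  rw [c.vals_of_label_zero fun g hg => hY g (Multiset.mem_of_le (hU.trans hY') hg), hUs]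
  rfl

section Split

variable [Fact p.Prime] [Fact q.Prime] {X Y : Multiset G}
  (hS : IsMinimalProductOne (X + Y)) (hX : ∀ g ∈ X, c.ℓ g ≠ 0) (hY : ∀ y ∈ Y, c.ℓ y = 0)
  (hb : ∀ y ∈ Y, c.β y ≠ 0)

omit [Fact q.Prime] in
include hS hY in
theorem label_eq_zero_of_minimal : c.label X = 0 := by
  have := ((c.isProductOne_iff _).1 hS.1).1
  rwa [c.label_add, c.label_of_label_zero hY, add_zero] at this

include hS hX hY hb

/-- If at least `3 * (q - 1) / 2` terms lie in the normal subgroup, a label-zero proper part of the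
other terms is completed to a product-one sequence by at most `(q - 1) / 2` of them, and enough of
them remain for the complement to be product-one. -/
theorem false_of_normal_dominated (hodd : Odd q) {T : Multiset G} (hT : T ≤ X) (hT0 : T ≠ 0)
    (hTX : T ≠ X) (hTl : c.label T = 0) (hcard : 3 * (q - 1) ≤ 2 * Y.card) : False := by
  classical
  obtain ⟨j, hj⟩ := hodd
  obtain ⟨Y', hY', hc⟩ := Multiset.exists_le_card_eq (n := j) (S := Y) (by omega)
  obtain ⟨W, hW, hv⟩ := c.exists_zero_mem_vals_of_normal hT0
    (fun g hg => hX g (Multiset.mem_of_le hT hg))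
    (fun y hy => hY y (Multiset.mem_of_le hY' hy))
    (fun y hy => hb y (Multiset.mem_of_le hY' hy)) (by omega)
  have hWY := hW.trans hY'
  have hWc := Multiset.card_le_card hW
  have hTlt : T.card < X.card :=
    lt_of_le_of_ne (Multiset.card_le_card hT) fun h => hTX (Multiset.eq_of_le_of_card_le hT h.ge)
  have hR : X + Y - (T + W) = (X - T) + (Y - W) := by
    ext g
    simp only [Multiset.count_sub, Multiset.count_add]
    have := Multiset.count_le_of_le g hT
    have := Multiset.count_le_of_le g hWY
    omega
  refine c.not_split hS (add_le_add hT hWY) (by simp [hT0]) ?_ ?_ hv ?_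
  · have := Multiset.card_le_card hWY
    simp only [Multiset.card_add]; omega
  · rw [c.label_add, hTl, c.label_of_label_zero fun g hg => hY g (Multiset.mem_of_le hWY hg),
      add_zero]
  · rw [hR]
    apply c.mem_vals_of_normal
    · intro h
      have := congrArg Multiset.card h
      rw [Multiset.card_sub hT] at this
      simp at this; omega
    · exact fun g hg => hX g (Multiset.mem_of_le (Multiset.sub_le_self _ _) hg)
    · exact fun g hg => hY g (Multiset.mem_of_le (Multiset.sub_le_self _ _) hg)
    · exact fun g hg => hb g (Multiset.mem_of_le (Multiset.sub_le_self _ _) hg)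
    · rw [Multiset.card_sub hWY]; omega

/-- If the terms outside the normal subgroup form a single piece of length at least three, a zero-sum
subsequence of the other terms splits off: the piece has at least three prefix labels, so each
remaining term contributes two values. -/
theorem false_of_isPiece (hpq : 2 * p + 1 ≤ q) (hXp : c.IsPiece X) (h3 : 3 ≤ X.card)
    (hcard : X.card + Y.card = 2 * q) : False := by
  classical
  have hXle := IsPiece.card_le c hXp
  obtain ⟨U, hU, hU0, hUc, hv⟩ := c.exists_zero_sum_normal hY (by omega)
  have hR : X + Y - U = X + (Y - U) := by
    ext g
    simp only [Multiset.count_sub, Multiset.count_add]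
    have := Multiset.count_le_of_le g hU
    omega
  have hUY := Multiset.card_le_card hU
  refine c.not_split hS (hU.trans (Multiset.le_add_left _ _)) hU0
    (by rw [Multiset.card_add]; omega)
    (c.label_of_label_zero fun g hg => hY g (Multiset.mem_of_le hU hg)) hv ?_
  rw [hR]
  obtain ⟨l, rfl⟩ : ∃ l : List G, (l : Multiset G) = X := ⟨X.toList, by simp⟩
  have hK := IsPiece.card_le_prefixes c hXp
  rw [Multiset.coe_card] at *
  apply c.reach_subset_vals (c.prefixes l)
  refine mem_of_min_le_ncard (c.reach_normal ⟨0, c.zero_mem_prefixes l⟩ (c.one_le_reach l)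
    (Y := Y - U) (fun g hg => hY g (Multiset.mem_of_le (Multiset.sub_le_self _ _) hg))
    (fun g hg => hb g (Multiset.mem_of_le (Multiset.sub_le_self _ _) hg))) ?_ 0
  have h1 : (Y - U).card * 2 ≤ (Y - U).card * ((c.prefixes l).ncard - 1) :=
    Nat.mul_le_mul_left _ (by omega)
  rw [Multiset.card_sub hU] at *
  omega

end Split

/-! ### Sequences without short product-one subsequences -/

/-- If there are no product-one subsequences of length at most `p`, then there is none of length
less than `q` whose complement leaves the normal subgroup: the complement is product-one as well. -/
theorem false_of_card_lt [Fact p.Prime] [Fact q.Prime] (hp3 : 3 ≤ p) {M : ℕ}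
    (hq : q = M * p + 1) [DecidableEq G] {S : Multiset G} (hS : IsMinimalProductOne S)
    (hcard : S.card = 2 * q)
    (hshort : ∀ T ≤ S, T ≠ 0 → T.card ≤ p → c.label T = 0 → (0 : ZMod q) ∉ c.vals T)
    {U : Multiset G} (hU : U ≤ S) (hU0 : U ≠ 0) (hUc : U.card < q) (hUl : c.label U = 0)
    (hUv : (0 : ZMod q) ∈ c.vals U) (hR : ∃ g ∈ S - U, c.ℓ g ≠ 0) : False := by
  refine c.not_split hS hU hU0 (by omega) hUl hUv (c.zero_mem_vals_of_long hp3 hq ?_ ?_ hR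
    fun T h => hshort T (h.trans (Multiset.sub_le_self _ _)))
  · rw [c.label_sub hU, hUl, ((c.isProductOne_iff _).1 hS.1).1, sub_zero]
  · rw [Multiset.card_sub hU]; omega

/-- If at least `(q - 1) / 2` terms lie in the normal subgroup, a piece outside it is completed by them
to a product-one subsequence of length less than `q`. -/
theorem false_of_normal_half [Fact p.Prime] [Fact q.Prime] (hp3 : 3 ≤ p) {k : ℕ} (hk : 1 ≤ k)
    (hq : q = 2 * k * p + 1) {X Y : Multiset G} (hS : IsMinimalProductOne (X + Y))
    (hX : ∀ g ∈ X, c.ℓ g ≠ 0) (hY : ∀ y ∈ Y, c.ℓ y = 0) (hb : ∀ y ∈ Y, c.β y ≠ 0)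
    {T : Multiset G} (hT : T ≤ X) (hTp : c.IsPiece T) (hTX : T ≠ X)
    (hcard : X.card + Y.card = 2 * q) (hhalf : q ≤ 2 * Y.card + 1)
    (hshort : ∀ T ≤ X + Y, T ≠ 0 → T.card ≤ p → c.label T = 0 → (0 : ZMod q) ∉ c.vals T) :
    False := by
  classical
  have e1 : 2 * k * p = 2 * (k * p) := by ring
  have hkp : p ≤ k * p := Nat.le_mul_of_pos_left p hk
  obtain ⟨Y', hY', hc⟩ := Multiset.exists_le_card_eq (n := k * p) (S := Y) (by omega)
  obtain ⟨W, hW, hv⟩ := c.exists_zero_mem_vals_of_normal hTp.ne_zero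
    (fun g hg => hX g (Multiset.mem_of_le hT hg))
    (fun y hy => hY y (Multiset.mem_of_le hY' hy))
    (fun y hy => hb y (Multiset.mem_of_le hY' hy)) (by omega)
  have hWY := hW.trans hY'
  have hWc := Multiset.card_le_card hW
  have hTc := IsPiece.card_le c hTp
  refine c.false_of_card_lt hp3 hq hS (by simpa using hcard) hshort (add_le_add hT hWY)
    (by simp [hTp.ne_zero]) (by rw [Multiset.card_add]; omega) ?_ hv ?_
  · rw [c.label_add, hTp.label_eq,
      c.label_of_label_zero fun g hg => hY g (Multiset.mem_of_le hWY hg), add_zero]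
  · have hTlt : T.card < X.card := lt_of_le_of_ne (Multiset.card_le_card hT)
      fun h => hTX (Multiset.eq_of_le_of_card_le hT h.ge)
    obtain ⟨g, hg⟩ : ∃ g, g ∈ X - T := Multiset.card_pos_iff_exists_mem.1 (by
      rw [Multiset.card_sub hT]; omega)
    have hle : X - T ≤ X + Y - (T + W) := by
      rw [le_tsub_iff_right (add_le_add hT hWY)]
      calc X - T + (T + W) = (X - T + T) + W := (add_assoc _ _ _).symm
        _ = X + W := by rw [Multiset.sub_add_cancel hT]
        _ ≤ X + Y := by gcongr
    exact ⟨g, Multiset.mem_of_le hle hg,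
      hX g (Multiset.mem_of_le (Multiset.sub_le_self _ _) hg)⟩

/-! ### Noncommuting blocks -/

open Classical in
/-- The maximal abelian subgroup containing a nontrivial element: `none` stands for the normal
subgroup of order `q`, and `some f` for the stabilizer of the point `f` of `ZMod q`. -/
noncomputable def cls [Fact q.Prime] (g : G) : Option (ZMod q) :=
  if c.ℓ g = 0 then none else some (c.β g / (1 - c.χ (c.ℓ g)))

theorem cls_eq_none [Fact q.Prime] {g : G} : c.cls g = none ↔ c.ℓ g = 0 := by
  unfold cls; split_ifs with h <;> simp [h]

theorem χ_ne_one {a : ZMod p} (ha : a ≠ 0) : c.χ a ≠ 1 := by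
  intro h
  rw [← c.χ_zero] at h
  exact ha (c.χ_inj h)

theorem one_sub_χ_ne_zero {a : ZMod p} (ha : a ≠ 0) : 1 - c.χ a ≠ 0 :=
  sub_ne_zero.2 (c.χ_ne_one ha).symm

theorem cls_eq_some [Fact q.Prime] {g : G} {f : ZMod q} :
    c.cls g = some f ↔ c.ℓ g ≠ 0 ∧ c.β g = f * (1 - c.χ (c.ℓ g)) := by
  unfold cls
  split_ifs with h
  · simp [h]
  · rw [Option.some_inj, div_eq_iff (c.one_sub_χ_ne_zero h)]
    simp [h]

theorem β_mul_ne [Fact q.Prime] {g h : G} (hg : c.ℓ g = 0 → c.β g ≠ 0)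
    (hh : c.ℓ h = 0 → c.β h ≠ 0) (hgh : c.cls g ≠ c.cls h) : c.β (g * h) ≠ c.β (h * g) := by
  intro heq
  rw [c.β_mul, c.β_mul] at heq
  by_cases h1 : c.ℓ g = 0
  · by_cases h2 : c.ℓ h = 0
    · exact hgh (by rw [c.cls_eq_none.2 h1, c.cls_eq_none.2 h2])
    · rw [h1, c.χ_zero] at heq
      have : c.β g * (1 - c.χ (c.ℓ h)) = 0 := by linear_combination heq
      exact (mul_ne_zero (hg h1) (c.one_sub_χ_ne_zero h2)) this
  · by_cases h2 : c.ℓ h = 0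
    · rw [h2, c.χ_zero] at heq
      have : c.β h * (1 - c.χ (c.ℓ g)) = 0 := by linear_combination -heq
      exact (mul_ne_zero (hh h2) (c.one_sub_χ_ne_zero h1)) this
    · apply hgh
      have e1 := c.one_sub_χ_ne_zero h1
      have e2 := c.one_sub_χ_ne_zero h2
      unfold cls
      rw [if_neg h1, if_neg h2, Option.some_inj, div_eq_div_iff e1 e2]
      linear_combination heq

theorem vals_ncard_add_step [Fact q.Prime] {A B : Multiset G} {x y : ℕ}
    (hA : min q (x + 1) ≤ (c.vals A).ncard) (hB : y + 1 ≤ (c.vals B).ncard) :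
    min q (x + y + 1) ≤ (c.vals (A + B)).ncard := by
  have hinj : Function.Injective fun b => c.χ (c.label A) * b :=
    mul_right_injective₀ (c.χ_ne_zero _)
  refine cauchyDavenport_step hA (B := (fun b => c.χ (c.label A) * b) '' c.vals B)
    (by rwa [Set.ncard_image_of_injective _ hinj]) ?_
  rintro a ha _ ⟨b, hb, rfl⟩
  exact c.vals_add ha hb

theorem vals_ncard_le_add [Fact q.Prime] (A B : Multiset G) :
    (c.vals A).ncard ≤ (c.vals (A + B)).ncard := by
  have h1 := (Set.ncard_pos (Set.toFinite _)).2 (c.vals_nonempty A)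
  have h2 := (Set.ncard_pos (Set.toFinite _)).2 (c.vals_nonempty B)
  have h3 := c.vals_ncard_add_step (A := A) (B := B) (x := (c.vals A).ncard - 1) (y := 0)
    (by rw [Nat.sub_add_cancel h1]; exact min_le_right _ _) h2
  have h4 := Set.ncard_le_card (c.vals A)
  rw [Nat.card_zmod] at h4
  omega

/-- Multiplying by a term `z` outside the normal subgroup on either side gives a new value, unless
the set of values is stable under a rotation of order `p`. -/
theorem vals_ncard_add_singleton [Fact p.Prime] [Fact q.Prime] {B : Multiset G}
    (hB : 2 ≤ (c.vals B).ncard) {z : G} (hz : c.ℓ z ≠ 0) :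
    min p ((c.vals B).ncard + 1) ≤ (c.vals (B + {z})).ncard := by
  by_contra hcon
  set X := c.vals B with hX
  set A : Set (ZMod q) := (fun x => x + c.χ (c.label B) * c.β z) '' X with hA
  have hz1 : c.β z ∈ c.vals {z} := ⟨[z], by simp, by simp⟩
  have hAsub : A ⊆ c.vals (B + {z}) := by
    rintro _ ⟨x, hx, rfl⟩
    exact c.vals_add hx hz1
  have hAc : A.ncard = X.ncard := Set.ncard_image_of_injective _ (add_left_injective _)
  have hA' : A = c.vals (B + {z}) := Set.eq_of_subset_of_ncard_le hAsub (by omega)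
  set e := c.β z - c.χ (c.label B) * c.β z with he
  have hstab : ∀ x ∈ X, c.χ (c.ℓ z) * x + e ∈ X := by
    intro x hx
    have h1 := c.vals_add hz1 hx
    rw [add_comm ({z} : Multiset G) B, ← hA', c.label_singleton] at h1
    obtain ⟨y, hy, hxy⟩ := h1
    convert hy using 1
    change y + _ = _ at hxy
    rw [he]
    linear_combination -hxy
  -- the fixed point of the rotation
  set f := e / (1 - c.χ (c.ℓ z)) with hf
  have hef : e = f * (1 - c.χ (c.ℓ z)) := by
    rw [hf, div_mul_cancel₀ _ (c.one_sub_χ_ne_zero hz)]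
  obtain ⟨x, hx, hxf⟩ := Set.exists_ne_of_one_lt_ncard (by omega : 1 < X.ncard) f
  have hpow : ∀ n : ℕ, f + c.χ (n * c.ℓ z) * (x - f) ∈ X := by
    intro n
    induction n with
    | zero => simpa using hx
    | succ n ih =>
      convert hstab _ ih using 1
      rw [hef, Nat.cast_succ, add_mul, one_mul, c.χ_add]
      ring
  have hsub : (fun w => f + w) '' (Set.range fun κ => c.χ κ * (x - f)) ⊆ X := by
    rintro _ ⟨_, ⟨κ, rfl⟩, rfl⟩
    have := hpow (κ / c.ℓ z).val
    rwa [ZMod.natCast_val, ZMod.cast_id', id, div_mul_cancel₀ _ hz] at this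
  have h1 := Set.ncard_le_ncard hsub (Set.toFinite _)
  rw [Set.ncard_image_of_injective _ (add_right_injective _),
    c.orbit_ncard (sub_ne_zero.2 hxf)] at h1
  rw [← hA', hAc] at hcon
  omega

theorem vals_ncard_add_of_ne_zero [Fact p.Prime] [Fact q.Prime] {B Z : Multiset G}
    (hB : 2 ≤ (c.vals B).ncard) (hZ : ∀ z ∈ Z, c.ℓ z ≠ 0) :
    min p ((c.vals B).ncard + Z.card) ≤ (c.vals (B + Z)).ncard := by
  induction Z using Multiset.induction with
  | empty => simp
  | cons z Z ih =>
    have h1 := ih fun a ha => hZ a (Multiset.mem_cons_of_mem ha)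
    have h2 := c.vals_ncard_le_add B Z
    have h3 := c.vals_ncard_add_singleton (B := B + Z) (by omega) (hZ z (Multiset.mem_cons_self _ _))
    rw [show B + z ::ₘ Z = B + Z + {z} by rw [← Multiset.singleton_add]; abel, Multiset.card_cons]
    omega

/-- A noncommutative sequence has at least as many products as terms, up to `p`. -/
theorem block_ncard [Fact p.Prime] [Fact q.Prime] (hpq : p ≤ q) {B : Multiset G}
    (hB : ∀ g ∈ B, c.ℓ g = 0 → c.β g ≠ 0) {g h : G} (hgh : {g, h} ≤ B) (hne : c.cls g ≠ c.cls h) :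
    min p B.card ≤ (c.vals B).ncard := by
  classical
  have hgB : g ∈ B := Multiset.mem_of_le hgh (by simp)
  have hhB : h ∈ B := Multiset.mem_of_le hgh (by simp)
  by_cases hN : ∃ y ∈ B, c.ℓ y = 0
  · obtain ⟨y, hy, hy0⟩ := hN
    obtain ⟨x, hx, hx0⟩ : ∃ x ∈ B, c.ℓ x ≠ 0 := by
      by_contra hcon
      push Not at hcon
      exact hne (by rw [c.cls_eq_none.2 (hcon g hgB), c.cls_eq_none.2 (hcon h hhB)])
    set Y := B.filter fun a => c.ℓ a = 0 with hYdef
    have hsplit := Multiset.filter_add_not (fun a => c.ℓ a = 0) B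
    obtain ⟨Z, hZ⟩ := Multiset.exists_cons_of_mem (a := x)
      (s := B.filter fun a => ¬ c.ℓ a = 0) (by simp [hx, hx0])
    rw [hZ] at hsplit
    have hY : ∀ a ∈ Y, c.ℓ a = 0 := fun a ha => (Multiset.mem_filter.1 ha).2
    have hYb : ∀ a ∈ Y, c.β a ≠ 0 := fun a ha =>
      hB a (Multiset.mem_filter.1 ha).1 (hY a ha)
    have hYpos : 0 < Y.card := Multiset.card_pos_iff_exists_mem.2 ⟨y, by simp [hYdef, hy, hy0]⟩
    have hZ0 : ∀ z ∈ Z, c.ℓ z ≠ 0 := fun z hz => by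
      have : z ∈ B.filter fun a => ¬ c.ℓ a = 0 := by rw [hZ]; exact Multiset.mem_cons_of_mem hz
      exact (Multiset.mem_filter.1 this).2
    obtain ⟨l, hl, h2⟩ := c.two_le_prefixes (X := {x}) (by simp) (by simpa using hx0)
    have h1 := c.reach_normal ⟨0, c.zero_mem_prefixes l⟩ (c.one_le_reach l) hY hYb
    have h3 : Y.card * 1 ≤ Y.card * ((c.prefixes l).ncard - 1) := Nat.mul_le_mul_left _ (by omega)
    have h4 := Set.ncard_le_ncard (c.reach_subset_vals (c.prefixes l) (l + Y)) (Set.toFinite _)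
    rw [hl] at h1 h4
    have hq2 := (Fact.out : q.Prime).two_le
    have h5 := c.vals_ncard_add_of_ne_zero (B := {x} + Y) (by omega) hZ0
    have h6 : B = {x} + Y + Z := by rw [← hsplit, ← Multiset.singleton_add]; abel
    rw [h6]
    have : ({x} + Y + Z).card = 1 + Y.card + Z.card := by
      simp only [Multiset.card_add, Multiset.card_singleton]
    omega
  · push Not at hN
    obtain ⟨Z, hZ⟩ := Multiset.le_iff_exists_add.1 hgh
    have h2 : 2 ≤ (c.vals ({g, h} : Multiset G)).ncard := by
      have hsub : {c.β (g * h), c.β (h * g)} ⊆ c.vals ({g, h} : Multiset G) := by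
        rintro v (rfl | rfl)
        · exact ⟨[g, h], rfl, by simp⟩
        · exact ⟨[h, g], by rw [Multiset.pair_comm]; rfl, by simp⟩
      have := Set.ncard_le_ncard hsub (Set.toFinite _)
      rwa [Set.ncard_pair (c.β_mul_ne (hB g hgB) (hB h hhB) hne)] at this
    have h3 := c.vals_ncard_add_of_ne_zero h2 (Z := Z) fun z hz =>
      hN z (by rw [hZ]; exact Multiset.mem_add.2 (Or.inr hz))
    rw [hZ, Multiset.card_add]
    have : ({g, h} : Multiset G).card = 2 := by simp
    omega

open Classical in
/-- Disjoint pairs of terms from different classes exist as soon as no class is too large: each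
pair takes one term from a largest class. -/
theorem exists_pairs [Fact q.Prime] (b : ℕ) (R : Multiset G) (h2 : 2 * b ≤ R.card)
    (hR : ∀ κ, b ≤ (R.filter fun g => c.cls g ≠ κ).card) :
    ∃ L : List (Multiset G), L.length = b ∧ L.sum ≤ R ∧
      ∀ P ∈ L, ∃ g h, P = {g, h} ∧ c.cls g ≠ c.cls h := by
  induction b generalizing R with
  | zero => exact ⟨[], rfl, by simp, by simp⟩
  | succ b ih =>
    obtain ⟨κ, hκ⟩ := Finite.exists_max fun κ => (R.filter fun g => c.cls g = κ).card
    have hcompl : ∀ κ, (R.filter fun g => c.cls g = κ).card +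
        (R.filter fun g => c.cls g ≠ κ).card = R.card := fun κ => by
      rw [← Multiset.card_add, Multiset.filter_add_not]
    obtain ⟨g, hg, hgκ⟩ : ∃ g ∈ R, c.cls g = κ := by
      obtain ⟨a, ha⟩ := Multiset.card_pos_iff_exists_mem.1 (by omega : 0 < R.card)
      have h1 : 0 < (R.filter fun g => c.cls g = c.cls a).card :=
        Multiset.card_pos_iff_exists_mem.2 ⟨a, by simp [ha]⟩
      obtain ⟨g, hg⟩ := Multiset.card_pos_iff_exists_mem.1 (lt_of_lt_of_le h1 (hκ _))
      exact ⟨g, Multiset.mem_filter.1 hg⟩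
    obtain ⟨h, hh⟩ := Multiset.card_pos_iff_exists_mem.1 (lt_of_lt_of_le b.succ_pos (hR κ))
    rw [Multiset.mem_filter] at hh
    obtain ⟨R₁, rfl⟩ := Multiset.exists_cons_of_mem hg
    have hhg : h ≠ g := fun e => hh.2 (e ▸ hgκ)
    obtain ⟨R', rfl⟩ := Multiset.exists_cons_of_mem
      ((Multiset.mem_cons.1 hh.1).resolve_left hhg)
    obtain ⟨L, hL, hLs, hLP⟩ := ih R' (by simp at h2; omega) (by
      intro κ'
      have h3 := hR κ'
      have h4 := hκ κ'
      have h5 := hcompl κ'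
      have hgh' : c.cls h ≠ c.cls g := hgκ ▸ hh.2
      by_cases e1 : c.cls g = κ'
      · rw [Multiset.filter_cons_of_neg _ (by simp [e1]),
          Multiset.filter_cons_of_pos _ (by rw [← e1]; exact hgh'), Multiset.card_cons] at h3
        omega
      · by_cases e2 : c.cls h = κ'
        · rw [Multiset.filter_cons_of_pos (p := fun g => c.cls g ≠ κ') _ e1,
            Multiset.filter_cons_of_neg (p := fun g => c.cls g ≠ κ') _ (by simp [e2]),
            Multiset.card_cons] at h3
          omega
        · rw [Multiset.filter_cons_of_pos (p := fun g => c.cls g ≠ κ') _ e1,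
            Multiset.filter_cons_of_pos (p := fun g => c.cls g ≠ κ') _ e2,
            Multiset.card_cons, Multiset.card_cons] at h5
          have h6 : ((g ::ₘ h ::ₘ R').filter fun g => c.cls g = κ).card =
              (R'.filter fun g => c.cls g = κ).card + 1 := by
            rw [Multiset.filter_cons_of_pos (p := fun g => c.cls g = κ) _ hgκ,
              Multiset.filter_cons_of_neg (p := fun g => c.cls g = κ) _ hh.2,
              Multiset.card_cons]
          have h7 : (R'.filter fun g => c.cls g = κ).card ≤
              (R'.filter fun g => c.cls g ≠ κ').card := by
            apply Multiset.card_le_card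
            apply Multiset.monotone_filter_right
            intro a ha ha'
            exact e1 (hgκ.trans (ha.symm.trans ha'))
          simp only [Multiset.card_cons] at h2 h5
          change ((g ::ₘ h ::ₘ R').filter fun g => c.cls g = κ').card ≤
            ((g ::ₘ h ::ₘ R').filter fun g => c.cls g = κ).card at h4
          omega)
    refine ⟨{g, h} :: L, by simp [hL], ?_, ?_⟩
    · rw [List.sum_cons]
      have : g ::ₘ h ::ₘ R' = {g, h} + R' := by
        rw [Multiset.insert_eq_cons]; simp
      rw [this]
      gcongr
    · intro P hP
      rcases List.mem_cons.1 hP with rfl | hP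
      · exact ⟨g, h, rfl, hgκ ▸ hh.2.symm⟩
      · exact hLP P hP

/-- Disjoint noncommuting pairs are completed to blocks of size `p`, each of which contributes
`p - 1` to the Cauchy–Davenport bound. -/
theorem blocks_ncard [Fact p.Prime] [Fact q.Prime] (hpq : p ≤ q) (L : List (Multiset G))
    (R : Multiset G) (hR : ∀ g ∈ R, c.ℓ g = 0 → c.β g ≠ 0) (hL : L.sum ≤ R)
    (hP : ∀ P ∈ L, ∃ g h, P = {g, h} ∧ c.cls g ≠ c.cls h) (hcard : L.length * p ≤ R.card) :
    min q (L.length * (p - 1) + 1) ≤ (c.vals R).ncard := by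
  classical
  have hp2 := (Fact.out : p.Prime).two_le
  induction L generalizing R with
  | nil =>
    have := (Set.ncard_pos (Set.toFinite _)).2 (c.vals_nonempty R)
    simp only [List.length_nil]
    omega
  | cons P L ih =>
    obtain ⟨g, h, rfl, hne⟩ := hP P List.mem_cons_self
    rw [List.sum_cons] at hL
    rw [List.length_cons, add_mul, one_mul] at hcard
    have hLc : L.sum.card = 2 * L.length := by
      have : ∀ L : List (Multiset G), (∀ P ∈ L, ∃ g h, P = {g, h} ∧ c.cls g ≠ c.cls h) →
          L.sum.card = 2 * L.length := by
        intro L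
        induction L with
        | nil => simp
        | cons P L ih =>
          intro h
          obtain ⟨a, b, rfl, -⟩ := h P List.mem_cons_self
          have := ih fun P hP => h P (List.mem_cons_of_mem _ hP)
          simp [this]; ring
      exact this L fun P hP' => hP P (List.mem_cons_of_mem _ hP')
    have hc2 : ({g, h} : Multiset G).card = 2 := by simp
    have h1 : 2 * L.length ≤ L.length * p := by rw [mul_comm]; exact Nat.mul_le_mul_left _ hp2
    obtain ⟨W, hW, hWc⟩ := Multiset.exists_le_card_eq (n := p - 2) (S := R - ({g, h} + L.sum)) (by
      rw [Multiset.card_sub hL, Multiset.card_add, hLc, hc2]; omega)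
    have hBR : ({g, h} + W) + L.sum ≤ R := by
      have := add_le_add_right hW ({g, h} + L.sum)
      rw [add_tsub_cancel_of_le hL] at this
      refine le_trans (le_of_eq ?_) this
      abel
    have hBR' : {g, h} + W ≤ R := le_trans (Multiset.le_add_right _ _) hBR
    have hblock := c.block_ncard hpq (B := {g, h} + W)
      (fun a ha => hR a (Multiset.mem_of_le hBR' ha)) (Multiset.le_add_right _ _) hne
    rw [Multiset.card_add, hc2, hWc, show 2 + (p - 2) = p by omega, min_self] at hblock
    have hrest := ih (R - ({g, h} + W))
      (fun a ha => hR a (Multiset.mem_of_le (Multiset.sub_le_self _ _) ha))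
      (by rw [le_tsub_iff_left hBR']; exact hBR)
      (fun P hP' => hP P (List.mem_cons_of_mem _ hP'))
      (by rw [Multiset.card_sub hBR', Multiset.card_add, hc2, hWc]; omega)
    have := c.vals_ncard_add_step hrest (B := {g, h} + W) (y := p - 1) (by omega)
    rw [Multiset.sub_add_cancel hBR'] at this
    rw [List.length_cons, add_mul, one_mul]
    exact this

/-! ### Terms fixing a common point -/

theorem β_of_cls [Fact q.Prime] {f : ZMod q} (l : List G) (hl : ∀ g ∈ l, c.cls g = some f) :
    c.β l.prod = f * (1 - c.χ (c.ℓ l.prod)) := by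
  induction l with
  | nil => simp [c.β_one, c.ℓ_one]
  | cons g l ih =>
    rw [List.prod_cons, c.β_mul, c.ℓ_mul, ih fun a ha => hl a (List.mem_cons_of_mem _ ha),
      (c.cls_eq_some.1 (hl g List.mem_cons_self)).2, c.χ_add]
    ring

/-- Among `p` consecutive terms some segment has label zero. -/
theorem exists_segment [NeZero p] (l : List G) (hl : p ≤ l.length) :
    ∃ a u b, l = a ++ u ++ b ∧ u ≠ [] ∧ u.length ≤ p ∧ c.ℓ u.prod = 0 := by
  obtain ⟨i, j, hij, heq⟩ : ∃ i j : Fin (p + 1), i < j ∧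
      c.ℓ (l.take i).prod = c.ℓ (l.take j).prod := by
    obtain ⟨i, j, hne, h⟩ := Fintype.exists_ne_map_eq_of_card_lt
      (fun i : Fin (p + 1) => c.ℓ (l.take i).prod) (by simp)
    rcases lt_or_gt_of_ne hne with h1 | h1
    · exact ⟨i, j, h1, h⟩
    · exact ⟨j, i, h1, h.symm⟩
  have hi := i.2
  have hj := j.2
  have hij' : (i : ℕ) < j := hij
  have hspl : l.take j = l.take i ++ (l.take j).drop i := by
    conv_lhs => rw [← List.take_append_drop i (l.take j)]
    rw [List.take_take, min_eq_left hij'.le]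
  have hlen : ((l.take j).drop i).length = j - i := by simp; omega
  refine ⟨l.take i, (l.take j).drop i, l.drop j, ?_, ?_, by omega, ?_⟩
  · rw [← hspl, List.take_append_drop]
  · intro h
    rw [h] at hlen
    simp at hlen; omega
  · rw [hspl, List.prod_append, c.ℓ_mul] at heq
    simpa using heq

open Classical in
/-- In a minimal product-one sequence, any `p` consecutive terms of a product-one ordering include
one that does not fix a given point. -/
theorem card_not_fixing [Fact p.Prime] [Fact q.Prime] {S : Multiset G} (hS : IsMinimalProductOne S)
    (f : ZMod q) {j : ℕ} (hj : j * p ≤ S.card) (hp : p < S.card) :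
    j ≤ (S.filter fun g => c.cls g ≠ some f).card := by
  obtain ⟨l, rfl, hl⟩ := hS.1
  have hwin : ∀ a u b, l = a ++ u ++ b → u.length = p → ∃ g ∈ u, c.cls g ≠ some f := by
    intro a u b hlu hu
    by_contra hcon
    push Not at hcon
    obtain ⟨a', w, b', rfl, hw0, hwp, hwl⟩ := c.exists_segment u hu.ge
    have hβ := c.β_of_cls w fun g hg => hcon g (by simp [hg])
    rw [hwl, c.χ_zero, sub_self, mul_zero] at hβ
    have hw1 := c.eq_one _ hwl hβ
    have hle : (w : Multiset G) ≤ (l : Multiset G) := by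
      rw [hlu]
      simp only [← Multiset.coe_add]
      calc (w : Multiset G) ≤ w + (a + a' + b' + b) := Multiset.le_add_right _ _
        _ = _ := by abel
    refine c.not_split hS hle (by simpa using hw0) ?_ (by rw [← c.ℓ_prod, hwl])
      ⟨w, rfl, hβ⟩ ⟨a ++ a' ++ b' ++ b, ?_, ?_⟩
    · rw [Multiset.coe_card] at hp ⊢
      rw [Multiset.coe_card]; omega
    · rw [eq_tsub_iff_add_eq_of_le hle, hlu]
      simp only [← Multiset.coe_add]
      abel
    · rw [hlu] at hl
      simp only [List.prod_append, hw1, mul_one] at hl ⊢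
      rw [← mul_assoc (c := b'.prod)] at hl
      rw [hl, c.β_one]
  have key : ∀ (j : ℕ) (l : List G), j * p ≤ l.length →
      (∀ a u b, l = a ++ u ++ b → u.length = p → ∃ g ∈ u, c.cls g ≠ some f) →
      j ≤ ((l : Multiset G).filter fun g => c.cls g ≠ some f).card := by
    intro j
    induction j with
    | zero => intros; omega
    | succ j ih =>
      intro l hl hw
      rw [add_mul, one_mul] at hl
      have h1 := ih (l.drop p) (by rw [List.length_drop]; omega) (by
        intro a u b h
        refine hw (l.take p ++ a) u b ?_
        conv_lhs => rw [← List.take_append_drop p l, h]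
        simp)
      obtain ⟨g, hg, hgf⟩ := hw [] (l.take p) (l.drop p) (by simp)
        (by rw [List.length_take]; omega)
      have h2 : 0 < ((l.take p : Multiset G).filter fun g => c.cls g ≠ some f).card :=
        Multiset.card_pos_iff_exists_mem.2 ⟨g, by simp [hg, hgf]⟩
      have h3 : (l : Multiset G) = (l.take p : Multiset G) + (l.drop p : Multiset G) := by
        rw [Multiset.coe_add, List.take_append_drop]
      rw [h3, Multiset.filter_add, Multiset.card_add]
      omega
  exact key j l (by simpa using hj) hwin

open Classical in
/-- A minimal product-one sequence of length `2 * q` that is not dominated by the normal subgroup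
has no product-one subsequence of length at most `p`. If some point is fixed by `p` or more terms,
such a subsequence is taken among the terms fixing a most frequent point; its complement then
contains `3 * k` disjoint noncommuting pairs and attains every value. -/
theorem false_of_short [Fact p.Prime] [Fact q.Prime] (hp3 : 3 ≤ p) {k : ℕ} (hk : 1 ≤ k)
    (hq : q = 2 * k * p + 1) {S : Multiset G} (hS : IsMinimalProductOne S)
    (hb : ∀ g ∈ S, c.ℓ g = 0 → c.β g ≠ 0) (hcard : S.card = 2 * q)
    (hN : (S.filter fun g => c.ℓ g = 0).card < 3 * k * p)
    {U : Multiset G} (hU : U ≤ S) (hU0 : U ≠ 0) (hUp : U.card ≤ p) (hUl : c.label U = 0)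
    (hUv : (0 : ZMod q) ∈ c.vals U) : False := by
  have hkp : 3 * k ≤ k * p := by rw [mul_comm]; exact Nat.mul_le_mul_left k hp3
  have hkp' : p ≤ k * p := Nat.le_mul_of_pos_left p hk
  have e1 : 2 * k * p = 2 * (k * p) := by ring
  have e2 : 3 * k * p = 3 * (k * p) := by ring
  have hpk3 : p + 3 * k ≤ k * p + 3 := by
    obtain ⟨a, rfl⟩ := Nat.exists_eq_add_of_le hk
    obtain ⟨d, rfl⟩ := Nat.exists_eq_add_of_le hp3
    nlinarith [Nat.zero_le (a * d)]
  have hcompl : ∀ κ, (S.filter fun g => c.cls g = κ).card +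
      (S.filter fun g => c.cls g ≠ κ).card = S.card := fun κ => by
    rw [← Multiset.card_add, Multiset.filter_add_not]
  have hnone : (S.filter fun g => c.cls g = none).card < 3 * k * p := by
    simpa only [c.cls_eq_none] using hN
  -- it suffices to find one short product-one subsequence leaving enough terms outside each class
  have main : ∀ U ≤ S, U ≠ 0 → U.card ≤ p → c.label U = 0 → (0 : ZMod q) ∈ c.vals U →
      (∀ f, 3 * k ≤ ((S - U).filter fun g => c.cls g ≠ some f).card) → False := by
    intro U hU hU0 hUp hUl hUv hf
    have hUc := Multiset.card_sub hU
    have hcls : ∀ κ, 3 * k ≤ ((S - U).filter fun g => c.cls g ≠ κ).card := by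
      rintro (_ | f)
      · have h1 : (S.filter fun g => c.cls g ≠ none).card ≤
            ((S - U).filter fun g => c.cls g ≠ none).card + U.card := by
          conv_lhs => rw [← Multiset.sub_add_cancel hU, Multiset.filter_add, Multiset.card_add]
          have := Multiset.card_le_card (Multiset.filter_le (fun g => c.cls g ≠ none) U)
          omega
        have := hcompl none
        omega
      · exact hf f
    obtain ⟨L, hL, hLs, hLP⟩ := c.exists_pairs (3 * k) (S - U) (by omega) hcls
    have hfull := c.blocks_ncard (by omega) L (S - U)
      (fun g hg => hb g (Multiset.mem_of_le (Multiset.sub_le_self _ _) hg)) hLs hLP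
      (by rw [hL]; omega)
    refine c.not_split hS hU hU0 (by omega) hUl hUv (mem_of_min_le_ncard hfull ?_ 0)
    rw [hL, Nat.mul_sub_one]
    omega
  have hsub : ∀ (U : Multiset G), U ≤ S → U.card ≤ p → ∀ f,
      (S.filter fun g => c.cls g = some f).card + p + 3 * k ≤ 2 * q →
      3 * k ≤ ((S - U).filter fun g => c.cls g ≠ some f).card := by
    intro U hU hUp f hf
    have h1 : (S.filter fun g => c.cls g ≠ some f).card ≤
        ((S - U).filter fun g => c.cls g ≠ some f).card + U.card := by
      conv_lhs => rw [← Multiset.sub_add_cancel hU, Multiset.filter_add, Multiset.card_add]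
      have := Multiset.card_le_card (Multiset.filter_le (fun g => c.cls g ≠ some f) U)
      omega
    have := hcompl (some f)
    omega
  by_cases hpop : ∃ f, p ≤ (S.filter fun g => c.cls g = some f).card
  · obtain ⟨f, hf⟩ := Finite.exists_max fun f => (S.filter fun g => c.cls g = some f).card
    have hfp : p ≤ (S.filter fun g => c.cls g = some f).card := by
      obtain ⟨f', hf'⟩ := hpop
      exact hf'.trans (hf f')
    obtain ⟨l, hl⟩ : ∃ l : List G, (l : Multiset G) = S.filter fun g => c.cls g = some f :=
      ⟨_, Multiset.coe_toList _⟩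
    obtain ⟨a, w, b, hw, hw0, hwp, hwl⟩ := c.exists_segment l (by
      rw [← Multiset.coe_card, hl]; exact hfp)
    have hwle : (w : Multiset G) ≤ S.filter fun g => c.cls g = some f := by
      rw [← hl, hw]
      simp only [← Multiset.coe_add]
      calc (w : Multiset G) ≤ w + (a + b) := Multiset.le_add_right _ _
        _ = _ := by abel
    have hwS : (w : Multiset G) ≤ S := hwle.trans (Multiset.filter_le _ _)
    have hwcls : ∀ g ∈ w, c.cls g = some f := fun g hg =>
      (Multiset.mem_filter.1 (Multiset.mem_of_le hwle (Multiset.mem_coe.2 hg))).2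
    refine main w hwS (by simpa using hw0) (by simpa using hwp) (by rw [← c.ℓ_prod, hwl])
      ⟨w, rfl, by rw [c.β_of_cls w hwcls, hwl, c.χ_zero]; ring⟩ ?_
    intro f'
    by_cases hff : f' = f
    · subst hff
      have h1 := c.card_not_fixing hS f' (j := 4 * k) (by
        rw [hcard, hq, show 4 * k * p = 2 * (2 * k * p) by ring]; omega) (by omega)
      have h2 : ((w : Multiset G).filter fun g => c.cls g ≠ some f') = 0 := by
        rw [Multiset.filter_eq_nil]
        intro g hg hne
        exact hne (hwcls g hg)
      have h3 : (S.filter fun g => c.cls g ≠ some f').card =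
          ((S - w).filter fun g => c.cls g ≠ some f').card := by
        conv_lhs => rw [← Multiset.sub_add_cancel hwS, Multiset.filter_add, Multiset.card_add, h2]
        simp
      omega
    · apply hsub w hwS (by simpa using hwp)
      have h1 := hf f'
      have h2 := hcompl (some f)
      have h3 : (S.filter fun g => c.cls g = some f').card ≤
          (S.filter fun g => c.cls g ≠ some f).card := by
        apply Multiset.card_le_card
        apply Multiset.monotone_filter_right
        intro a ha ha'
        rw [ha] at ha'
        exact hff (Option.some_inj.1 ha')
      omega
  · push Not at hpop
    refine main U hU hU0 hUp hUl hUv fun f => hsub U hU hUp f ?_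
    have := hpop f
    omega

/-! ### Many terms with the same label -/

theorem label_const {S : Multiset G} {t : ZMod p} (hS : ∀ g ∈ S, c.ℓ g = t) :
    c.label S = S.card * t := by
  rw [label, Multiset.map_congr rfl hS]; simp

theorem prefixes_const [Fact p.Prime] {l : List G} {t : ZMod p} (ht : t ≠ 0)
    (hl : ∀ g ∈ l, c.ℓ g = t) (hlen : p ≤ l.length) : c.prefixes l = Set.univ := by
  ext κ
  simp only [Set.mem_univ, iff_true]
  refine ⟨l.take (κ / t).val, l.drop (κ / t).val, (List.take_append_drop _ _).symm, ?_⟩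
  rw [c.ℓ_prod, c.label_const (t := t) fun g hg => hl g (List.mem_of_mem_take (by simpa using hg))]
  have := ZMod.val_lt (κ / t)
  rw [Multiset.coe_card, List.length_take, min_eq_left (by omega), ZMod.natCast_val,
    ZMod.cast_id', id, div_mul_cancel₀ _ ht]

/-- Choosing one term from each of several parts whose terms share a label and have distinct
translation parts. -/
theorem choice_card [Fact q.Prime] {t : ZMod p} (L : List (Multiset G))
    (ht : ∀ B ∈ L, ∀ g ∈ B, c.ℓ g = t) (hn : ∀ B ∈ L, (B.map c.β).Nodup)
    (h0 : ∀ B ∈ L, B ≠ 0) :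
    min q (L.sum.card - L.length + 1) ≤
      {v | ∃ l : List G, l.length = L.length ∧ (l : Multiset G) ≤ L.sum ∧ c.β l.prod = v}.ncard ∧
    L.length ≤ L.sum.card := by
  induction L with
  | nil =>
    refine ⟨min_le_of_right_le ?_, by simp⟩
    change 0 < _
    rw [Set.ncard_pos (Set.toFinite _)]
    exact ⟨_, [], rfl, by simp, rfl⟩
  | cons B L ih =>
    obtain ⟨ih1, ih2⟩ := ih (fun B hB => ht B (List.mem_cons_of_mem _ hB))
      (fun B hB => hn B (List.mem_cons_of_mem _ hB)) (fun B hB => h0 B (List.mem_cons_of_mem _ hB))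
    have hB := Multiset.card_pos.2 (h0 B List.mem_cons_self)
    have hBn := hn B List.mem_cons_self
    have hBc : {v | v ∈ B.map c.β}.ncard = B.card := by
      classical
      have : {v | v ∈ B.map c.β} = ((B.map c.β).toFinset : Set (ZMod q)) := by ext; simp
      rw [this, Set.ncard_coe_finset, Multiset.toFinset_card_of_nodup hBn, Multiset.card_map]
    have hinj : Function.Injective fun b => c.χ t * b := mul_right_injective₀ (c.χ_ne_zero _)
    rw [← Set.ncard_image_of_injective _ hinj] at ih1
    have h := cauchyDavenport_step (y := B.card - 1) (B := {v | v ∈ B.map c.β})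
      (C := {v | ∃ l : List G, l.length = (B :: L).length ∧ (l : Multiset G) ≤ (B :: L).sum ∧
        c.β l.prod = v}) ih1 (by omega) (by
        rintro _ ⟨_, ⟨l, hl1, hl2, rfl⟩, rfl⟩ _ hv
        obtain ⟨g, hg, rfl⟩ := Multiset.mem_map.1 hv
        refine ⟨g :: l, by simp [hl1], ?_, ?_⟩
        · rw [List.sum_cons, ← Multiset.cons_coe, ← Multiset.singleton_add]
          exact add_le_add (Multiset.singleton_le.2 hg) hl2
        · rw [List.prod_cons, c.β_mul, ht B List.mem_cons_self g hg, add_comm])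
    rw [List.sum_cons, Multiset.card_add, List.length_cons]
    refine ⟨?_, by omega⟩
    refine le_trans (le_of_eq ?_) h
    congr 1
    omega

/-- Any `p` terms contain a piece, and pieces have length at most `p`. -/
theorem exists_disjoint_pieces [Fact p.Prime] (j : ℕ) (W : Multiset G) (hW : j * p ≤ W.card) :
    ∃ Ts : Multiset (Multiset G), Ts.card = j ∧ (∀ T ∈ Ts, c.IsPiece T) ∧ Ts.sum ≤ W ∧
      Ts.sum.card ≤ j * p := by
  classical
  induction j generalizing W with
  | zero => exact ⟨0, by simp, by simp, by simp, by simp⟩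
  | succ j ih =>
    rw [add_mul, one_mul] at hW
    obtain ⟨a, u, b, hab, hu0, -, hul⟩ := c.exists_segment W.toList (by simp; omega)
    have huW : (u : Multiset G) ≤ W := by
      rw [← W.coe_toList, hab]
      simp only [← Multiset.coe_add]
      calc (u : Multiset G) ≤ u + (a + b) := Multiset.le_add_right _ _
        _ = _ := by abel
    obtain ⟨T, hT, hTp⟩ := c.exists_piece_le (R := u) (by simpa using hu0)
      (by rw [← c.ℓ_prod, hul])
    have hTW := hT.trans huW
    have hTc := IsPiece.card_le c hTp
    obtain ⟨Ts, h1, h2, h3, h4⟩ := ih (W - T) (by rw [Multiset.card_sub hTW]; omega)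
    refine ⟨T ::ₘ Ts, by simp [h1], ?_, ?_, ?_⟩
    · intro T' hT'
      rcases Multiset.mem_cons.1 hT' with rfl | h
      · exact hTp
      · exact h2 _ h
    · rw [Multiset.sum_cons, add_comm]
      have := add_le_add_left h3 T
      rwa [Multiset.sub_add_cancel hTW] at this
    · rw [Multiset.sum_cons, Multiset.card_add, add_mul, one_mul]; omega

open Classical in
/-- If some nonzero label is carried by at least `2 * p` terms, choosing `p` of them and some
pieces among the other terms gives a product-one subsequence of length less than `q`. -/
theorem card_label_lt [Fact p.Prime] [Fact q.Prime] (hp3 : 3 ≤ p) {k : ℕ}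
    (hq : q = 2 * k * p + 1) {S : Multiset G} (hS : IsMinimalProductOne S) (hcard : S.card = 2 * q)
    (hshort : ∀ T ≤ S, T ≠ 0 → T.card ≤ p → c.label T = 0 → (0 : ZMod q) ∉ c.vals T)
    {t : ZMod p} (ht : t ≠ 0) : (S.filter fun g => c.ℓ g = t).card < 2 * p := by
  by_contra hge
  push Not at hge
  set C := S.filter fun g => c.ℓ g = t with hC
  have hCt : ∀ g ∈ C, c.ℓ g = t := fun g hg => (Multiset.mem_filter.1 hg).2
  have hCS : C ≤ S := Multiset.filter_le _ _
  -- no translation part occurs more than `p` times, since `g ^ p = 1`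
  have hcount : ∀ b, (C.map c.β).count b ≤ p := by
    intro b
    by_contra hlt
    push Not at hlt
    rw [Multiset.count_map] at hlt
    obtain ⟨T, hT, hTc⟩ := Multiset.exists_le_card_eq hlt.le
    have hTC : T ≤ C := hT.trans (Multiset.filter_le _ _)
    have hTl : c.label T = 0 := by
      rw [c.label_const fun g hg => hCt g (Multiset.mem_of_le hTC hg), hTc]; simp
    refine hshort T (hTC.trans hCS) ?_ hTc.le hTl ⟨T.toList, by simp, ?_⟩
    · rw [← Multiset.card_pos]; omega
    · rw [c.β_of_cls (f := b / (1 - c.χ t)), c.ℓ_prod, Multiset.coe_toList, hTl, c.χ_zero]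
      · ring
      · intro g hg
        rw [Multiset.mem_toList] at hg
        have h1 := hCt g (Multiset.mem_of_le hTC hg)
        rw [c.cls_eq_some, h1, div_mul_cancel₀ _ (c.one_sub_χ_ne_zero ht)]
        exact ⟨ht, (Multiset.mem_filter.1 (Multiset.mem_of_le hT hg)).2.symm⟩
  obtain ⟨L, hL, hLs, hLn, hL0⟩ := exists_partition_injOn c.β p C hcount
  have hch := (c.choice_card (t := t) L
    (fun B hB g hg => hCt g (by
      rw [← hLs]; exact Multiset.mem_of_le (List.single_le_sum (by simp) B hB) hg))
    hLn (hL0 (by omega))).1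
  rw [hL, hLs] at hch
  set Y := {v | ∃ l : List G, l.length = p ∧ (l : Multiset G) ≤ C ∧ c.β l.prod = v} with hY
  have hlab : ∀ l : List G, l.length = p → (l : Multiset G) ≤ C → c.label l = 0 := by
    intro l hl hlC
    rw [c.label_const fun g hg => hCt g (Multiset.mem_of_le hlC hg), Multiset.coe_card, hl]
    simp
  have hY0 : (0 : ZMod q) ∉ Y := by
    rintro ⟨l, hl, hlC, hl0⟩
    refine hshort l (hlC.trans hCS) ?_ (by simp [hl]) (hlab l hl hlC) ⟨l, rfl, hl0⟩
    rintro h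
    have := congrArg Multiset.card h
    simp at this
    simp [this] at hl
    omega
  -- rotating the chosen terms shows that the set of values is invariant
  have hYinv : c.IsInvariant Y := by
    have step : ∀ y ∈ Y, c.χ (-t) * y ∈ Y := by
      rintro _ ⟨l, hl, hlC, rfl⟩
      cases l with
      | nil => simp at hl; omega
      | cons g l =>
        have hr := c.β_rotate (u := [g]) (v := l) (by
          rw [c.ℓ_prod]; exact hlab _ hl hlC)
        refine ⟨l ++ [g], by simpa using hl, ?_, ?_⟩
        · rw [← Multiset.coe_add, add_comm]; exact hlC
        · rw [hr, List.prod_singleton,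
            hCt g (Multiset.mem_of_le hlC (by simp))]
          rfl
    have hpow : ∀ n : ℕ, ∀ y ∈ Y, c.χ (n * -t) * y ∈ Y := by
      intro n
      induction n with
      | zero => intro y hy; simpa [c.χ_zero] using hy
      | succ n ih =>
        intro y hy
        have := step _ (ih y hy)
        rwa [← mul_assoc, ← c.χ_add, show -t + (n : ZMod p) * -t = ((n + 1 : ℕ) : ZMod p) * -t by
          push_cast; ring] at this
    intro κ y hy
    have := hpow (κ / -t).val y hy
    rwa [ZMod.natCast_val, ZMod.cast_id', id, div_mul_cancel₀ _ (neg_ne_zero.2 ht)] at this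
  obtain ⟨a, ha⟩ := (IsInvariant.ncard c hYinv).1 hY0
  have hcq : C.card - p + 1 < q := by
    by_contra hlt
    exact hY0 (mem_of_min_le_ncard hch (by omega) 0)
  rw [min_eq_right hcq.le, ha] at hch
  have hp0 : 0 < p := by omega
  have hu1 : C.card / p * p ≤ C.card := Nat.div_mul_le_self _ _
  have hu2 : C.card < (C.card / p + 1) * p := by
    rw [mul_comm]; exact Nat.lt_mul_div_succ _ hp0
  have hu3 : 2 ≤ C.card / p := (Nat.le_div_iff_mul_le hp0).2 hge
  set u := C.card / p with hu
  have hau : u ≤ a := by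
    by_contra hlt
    have : (a + 1) * p ≤ u * p := Nat.mul_le_mul_right p (by omega)
    rw [add_mul, one_mul] at this
    omega
  have huk : u ≤ 2 * k := by
    by_contra hlt
    have : (2 * k + 1) * p ≤ u * p := Nat.mul_le_mul_right p (by omega)
    rw [add_mul, one_mul] at this
    omega
  obtain ⟨j, hj⟩ := Nat.exists_eq_add_of_le huk
  have hkk : 2 * k * p = u * p + j * p := by rw [hj, add_mul]
  have h2u : 2 * p ≤ u * p := Nat.mul_le_mul_right p hu3
  rw [add_mul, one_mul] at hu2
  obtain ⟨Ts, hTs, hTp, hTW, hTc⟩ := c.exists_disjoint_pieces (j + 1) (S - C) (by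
    rw [Multiset.card_sub hCS, add_mul, one_mul]; omega)
  have hTS : Ts.sum ≤ S := hTW.trans (Multiset.sub_le_self _ _)
  have hreach : Y ⊆ c.subreach Set.univ {U | U ≤ C ∧ U.card = p} 0 := by
    rintro _ ⟨l, hl, hlC, rfl⟩
    refine ⟨l, ⟨hlC, by simpa using hl⟩, 0, le_rfl, by simp, l, by simp, ?_, rfl⟩
    rw [c.prefixes_const ht (fun g hg => hCt g (Multiset.mem_of_le hlC (by simpa using hg)))
      (by omega)]
  have hap : 0 < a * p := by omega
  have hfull := c.subreach_card (K := Set.univ) ⟨0, trivial⟩ (x := a * p - 1) (by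
    refine min_le_of_right_le ?_
    rw [Nat.sub_add_cancel hap, ← ha]
    exact Set.ncard_le_ncard hreach (Set.toFinite _)) Ts hTp (fun T hT =>
      hshort T ((Multiset.single_le_sum (by simp) T hT).trans hTS) (hTp T hT).ne_zero
        (IsPiece.card_le c (hTp T hT)) (hTp T hT).label_eq)
  have hsum : (Ts.map fun T => min p ((Set.univ : Set (ZMod p)).ncard + T.card - 1)).sum =
      (j + 1) * p := by
    rw [Multiset.map_congr rfl (g := fun _ => p)]
    · rw [Multiset.map_const', Multiset.sum_replicate, hTs, smul_eq_mul]
    · intro T hT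
      have := Multiset.card_pos.2 (hTp T hT).ne_zero
      rw [Set.ncard_univ, Nat.card_zmod]
      omega
  rw [hsum] at hfull
  have hua : u * p ≤ a * p := Nat.mul_le_mul_right p hau
  obtain ⟨U, ⟨hUC, hUc⟩, W, hW, hWl, hv⟩ := mem_of_min_le_ncard hfull (by
    rw [add_mul, one_mul]; omega) 0
  have hWc := Multiset.card_le_card hW
  have hUWc : (U + W).card = U.card + W.card := Multiset.card_add _ _
  have hle : U + W ≤ S := by
    rw [← add_tsub_cancel_of_le hCS]
    exact add_le_add hUC (hW.trans hTW)
  rw [add_mul, one_mul] at hTc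
  refine c.false_of_card_lt hp3 hq hS hcard hshort hle ?_ ?_ ?_ (c.reach_subset_vals _ _ hv) ?_
  · intro h
    rw [h, Multiset.card_zero] at hUWc
    omega
  · omega
  · rw [c.label_add, hWl, c.label_const fun g hg => hCt g (Multiset.mem_of_le hUC hg), hUc]
    simp
  · obtain ⟨g, hg⟩ : ∃ g, g ∈ C - U := Multiset.card_pos_iff_exists_mem.1 (by
      rw [Multiset.card_sub hUC]; omega)
    have hsub : C - U ≤ S - (U + W) := by
      rw [le_tsub_iff_right hle, ← add_assoc, Multiset.sub_add_cancel hUC]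
      conv_rhs => rw [← add_tsub_cancel_of_le hCS]
      exact add_le_add le_rfl (hW.trans hTW)
    refine ⟨g, Multiset.mem_of_le hsub hg, ?_⟩
    rw [hCt g (Multiset.mem_of_le (Multiset.sub_le_self _ _) hg)]
    exact ht

/-! ### Few terms with the same label -/

theorem _root_.Multiset.exists_minimal_sum_ge {α : Type*} (w : α → ℕ) (N : ℕ) (S : Multiset α)
    (h : N ≤ (S.map w).sum) :
    ∃ J ≤ S, N ≤ (J.map w).sum ∧ ∀ a J', J = a ::ₘ J' → (J'.map w).sum < N := by
  induction S using Multiset.strongInductionOn with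
  | ih S ih =>
    by_cases hS : ∀ a J', S = a ::ₘ J' → (J'.map w).sum < N
    · exact ⟨S, le_rfl, h, hS⟩
    · push Not at hS
      obtain ⟨a, J', rfl, hJ'⟩ := hS
      obtain ⟨J, h1, h2⟩ := ih J' (Multiset.lt_cons_self _ _) hJ'
      exact ⟨J, h1.trans (Multiset.le_cons_self _ _), h2⟩

/-- Among `p` terms, no label being repeated more than `h` times, there is a piece of length at
most `h`. -/
theorem exists_short_piece [Fact p.Prime] {h : ℕ} {V : Multiset G}
    (hV : p ≤ V.card) (hc : ∀ t, (V.map c.ℓ).count t ≤ h) :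
    ∃ T ≤ V, c.IsPiece T ∧ T.card ≤ h := by
  obtain ⟨L, hL, hLs, hLn, -⟩ := exists_partition_injOn c.ℓ h V hc
  obtain ⟨T, h0, hT, hTc, hTl⟩ := exists_zero_sum_selection c.ℓ L hLn (by rwa [hLs])
  obtain ⟨T', h1, h2⟩ := c.exists_piece_le h0 hTl
  exact ⟨T', h1.trans (hT.trans hLs.le), h2, (Multiset.card_le_card h1).trans (hTc.trans hL.le)⟩

open Classical in
/-- Two labels repeated more than `h = (p + 1) / 2` times supply `h` terms each, and `2 * h ≥ p`; one
such label leaves enough other terms. Either way `exists_short_piece` applies. -/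
theorem exists_short_piece_of_card [Fact p.Prime] {h : ℕ} (hh : 2 * h = p + 1) {E : Multiset G}
    (hE : 3 * p ≤ E.card + h + 1)
    (hlt : ∀ t, t ≠ 0 → (E.filter fun g => c.ℓ g = t).card < 2 * p) :
    ∃ T ≤ E, c.IsPiece T ∧ T.card ≤ h := by
  have hp2 := (Fact.out : p.Prime).two_le
  by_cases hz : ∃ g ∈ E, c.ℓ g = 0
  · obtain ⟨g, hg, hg0⟩ := hz
    exact ⟨{g}, Multiset.singleton_le.2 hg, c.isPiece_singleton hg0, by simp; omega⟩
  push Not at hz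
  have hcf : ∀ (V : Multiset G) t, (V.map c.ℓ).count t = (V.filter fun g => c.ℓ g = t).card := by
    intro V t
    rw [Multiset.count_map]
    simp only [eq_comm]
  by_cases h1 : ∀ t, (E.map c.ℓ).count t ≤ h
  · exact c.exists_short_piece (by omega) h1
  push Not at h1
  obtain ⟨t, ht⟩ := h1
  have ht0 : t ≠ 0 := by
    rintro rfl
    rw [Multiset.count_eq_zero_of_notMem] at ht
    · omega
    · intro hm
      obtain ⟨g, hg, hg0⟩ := Multiset.mem_map.1 hm
      exact hz g hg hg0
  have hsplit := Multiset.filter_add_not (fun g => c.ℓ g = t) E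
  have hEc := congrArg Multiset.card hsplit
  rw [Multiset.card_add] at hEc
  have htlt := hlt t ht0
  rw [hcf] at ht
  obtain ⟨A, hA, hAc⟩ := Multiset.exists_le_card_eq ht.le
  have hAt : ∀ g ∈ A, c.ℓ g = t := fun g hg => (Multiset.mem_filter.1 (Multiset.mem_of_le hA hg)).2
  have hA1 : (A.map c.ℓ).count t = h := by
    rw [hcf, Multiset.filter_eq_self.2 hAt, hAc]
  have hA2 : ∀ s, s ≠ t → (A.map c.ℓ).count s = 0 := by
    intro s hs
    rw [hcf, Multiset.card_eq_zero, Multiset.filter_eq_nil]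
    intro g hg hgs
    exact hs (hgs.symm.trans (hAt g hg))
  -- only `h` terms of the popular label are used, together with the terms of other labels
  have fin : ∀ B ≤ E.filter fun g => ¬ c.ℓ g = t, p ≤ h + B.card →
      (∀ s, (B.map c.ℓ).count s ≤ h) → ∃ T ≤ E, c.IsPiece T ∧ T.card ≤ h := by
    intro B hB hBc hBs
    have hle : A + B ≤ E := by
      rw [← hsplit]; exact add_le_add hA hB
    obtain ⟨T, hT, hTp⟩ := c.exists_short_piece (V := A + B)
      (by rw [Multiset.card_add, hAc]; exact hBc) (by
      intro s
      rw [Multiset.map_add, Multiset.count_add]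
      by_cases hs : s = t
      · have hB0 : (B.map c.ℓ).count t = 0 := by
          rw [hcf, Multiset.card_eq_zero, Multiset.filter_eq_nil]
          intro g hg
          exact (Multiset.mem_filter.1 (Multiset.mem_of_le hB hg)).2
        rw [hs, hA1, hB0, add_zero]
      · rw [hA2 s hs, zero_add]; exact hBs s)
    exact ⟨T, hT.trans hle, hTp⟩
  by_cases h2 : ∀ s, ((E.filter fun g => ¬ c.ℓ g = t).map c.ℓ).count s ≤ h
  · exact fin _ le_rfl (by omega) h2
  · push Not at h2
    obtain ⟨s, hs⟩ := h2
    rw [hcf] at hs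
    obtain ⟨B, hB, hBc⟩ := Multiset.exists_le_card_eq hs.le
    refine fin B (hB.trans (Multiset.filter_le _ _)) (by omega) fun r => ?_
    calc (B.map c.ℓ).count r ≤ (B.map c.ℓ).card := Multiset.count_le_card _ _
      _ = h := by rw [Multiset.card_map, hBc]

open Classical in
/-- Disjoint pieces of length at most `(p + 1) / 2` covering all but few terms, when no nonzero label
is carried by `2 * p` terms. -/
theorem exists_short_pieces [Fact p.Prime] {h : ℕ} (hh : 2 * h = p + 1) (E : Multiset G)
    (hlt : ∀ t, t ≠ 0 → (E.filter fun g => c.ℓ g = t).card < 2 * p) :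
    ∃ Ts : Multiset (Multiset G), (∀ T ∈ Ts, c.IsPiece T ∧ T.card ≤ h) ∧ Ts.sum ≤ E ∧
      E.card + h + 2 ≤ Ts.sum.card + 3 * p := by
  have hp2 := (Fact.out : p.Prime).two_le
  induction E using Multiset.strongInductionOn with
  | ih E ih =>
    by_cases hE : 3 * p ≤ E.card + h + 1
    · obtain ⟨T, hT, hTp, hTc⟩ := c.exists_short_piece_of_card hh hE hlt
      have hT0 := Multiset.card_pos.2 hTp.ne_zero
      have hTE := Multiset.card_le_card hT
      have hsub : E - T ≤ E := Multiset.sub_le_self _ _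
      obtain ⟨Ts, h1, h2, h3⟩ := ih (E - T) (by
        refine lt_of_le_of_ne hsub fun he => ?_
        have := congrArg Multiset.card he
        rw [Multiset.card_sub hT] at this; omega) (fun t ht =>
          lt_of_le_of_lt (Multiset.card_le_card (Multiset.filter_le_filter _ hsub)) (hlt t ht))
      refine ⟨T ::ₘ Ts, ?_, ?_, ?_⟩
      · intro T' hT'
        rcases Multiset.mem_cons.1 hT' with rfl | h
        · exact ⟨hTp, hTc⟩
        · exact h1 _ h
      · rw [Multiset.sum_cons, add_comm]
        have := add_le_add_left h2 T
        rwa [Multiset.sub_add_cancel hT] at this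
      · rw [Multiset.card_sub hT] at h3
        rw [Multiset.sum_cons, Multiset.card_add]
        omega
    · exact ⟨0, by simp, by simp, by simp; omega⟩

/-- The arithmetic behind the choice of pieces, for `p = 2 * h - 1` and `q = 2 * k * p + 1`. Here `K`
is the length of a longest piece and `J` lists the lengths of the pieces inserted into it, a piece of
length `x` contributing `x + K - 1` values. A minimal collection that suffices to attain every value
has total length less than `q`. -/
theorem _root_.Multiset.add_sum_le_of_minimal {k K h : ℕ} (hk : 1 ≤ k) (hK : 2 ≤ K) (hKh : K ≤ h)
    (J : Multiset ℕ) (hJ : ∀ x ∈ J, x ≤ K)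
    (hge : 2 * k * (2 * h - 1) ≤ J.sum + J.card * (K - 1))
    (hmin : ∀ x ∈ J, J.sum + J.card * (K - 1) < 2 * k * (2 * h - 1) + x + (K - 1)) :
    K + J.sum ≤ 2 * k * (2 * h - 1) := by
  obtain ⟨K, rfl⟩ : ∃ K', K = K' + 1 := ⟨K - 1, by omega⟩
  rw [Nat.add_sub_cancel] at *
  have hsum : J.sum ≤ J.card * (K + 1) := by
    simpa using Multiset.sum_le_card_nsmul J (K + 1) hJ
  set N := 2 * k * (2 * h - 1) with hN
  have hN2 : 2 * (2 * h - 1) ≤ N := Nat.mul_le_mul_right _ (by omega)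
  have hw2 : 2 ≤ J.card := by
    by_contra hlt
    have h1 : J.card * (K + 1) ≤ 1 * (K + 1) := Nat.mul_le_mul_right _ (by omega)
    have h2 : J.card * K ≤ 1 * K := Nat.mul_le_mul_right _ (by omega)
    omega
  obtain ⟨x, hx⟩ := Multiset.card_pos_iff_exists_mem.1 (by omega : 0 < J.card)
  have hxK := hJ x hx
  have hxm := hmin x hx
  by_cases hw4 : 4 ≤ J.card
  · have h1 : 4 * K ≤ J.card * K := Nat.mul_le_mul_right _ hw4
    omega
  -- fewer than four pieces suffice only if `k = 1`
  have hk1 : k = 1 := by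
    by_contra hne
    have h1 : 4 * (2 * h - 1) ≤ N := Nat.mul_le_mul_right _ (by omega)
    have h2 : J.card * (K + 1) ≤ 3 * (K + 1) := Nat.mul_le_mul_right _ (by omega)
    have h3 : J.card * K ≤ 3 * K := Nat.mul_le_mul_right _ (by omega)
    omega
  rw [hk1, mul_one] at hN
  by_cases hw3 : J.card = 3
  · rw [hw3] at hge hmin hsum
    by_cases hex : ∃ y ∈ J, y < K + 1
    · obtain ⟨y, hy, hyK⟩ := hex
      have := hmin y hy
      omega
    · push Not at hex
      have h1 : J.sum = 3 * (K + 1) := by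
        have := Multiset.card_nsmul_le_sum (s := J) (a := K + 1) hex
        rw [hw3, smul_eq_mul] at this
        omega
      have := hmin x hx
      omega
  · have hw : J.card = 2 := by omega
    rw [hw] at hsum
    omega

open Classical in
/-- If few terms lie in the normal subgroup and there are no product-one subsequences of length at
most `p`, then short pieces inserted into a longest one give a product-one subsequence of length less
than `q` that does not exhaust the terms outside the normal subgroup. -/
theorem false_of_normal_lt [Fact p.Prime] [Fact q.Prime] (hp3 : 3 ≤ p) {k : ℕ} (hk : 1 ≤ k)
    (hodd : Odd p) (hq : q = 2 * k * p + 1) {S : Multiset G} (hS : IsMinimalProductOne S)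
    (hcard : S.card = 2 * q) (hN : (S.filter fun g => c.ℓ g = 0).card < k * p)
    (hshort : ∀ T ≤ S, T ≠ 0 → T.card ≤ p → c.label T = 0 → (0 : ZMod q) ∉ c.vals T) : False := by
  obtain ⟨h', hh'⟩ := hodd
  obtain ⟨h, hh⟩ : ∃ h, 2 * h = p + 1 := ⟨h' + 1, by omega⟩
  have hkp : p ≤ k * p := Nat.le_mul_of_pos_left p hk
  have e1 : 2 * k * p = 2 * (k * p) := by ring
  obtain ⟨Ts, hTs, hTS, hTc⟩ := c.exists_short_pieces hh S
    fun t ht => c.card_label_lt hp3 hq hS hcard hshort ht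
  have hNlt : ∃ g ∈ Ts.sum, c.ℓ g ≠ 0 := by
    by_contra hcon
    push Not at hcon
    have : Ts.sum ≤ S.filter fun g => c.ℓ g = 0 := Multiset.le_filter.2 ⟨hTS, hcon⟩
    have := Multiset.card_le_card this
    omega
  obtain ⟨g, hg, hg0⟩ := hNlt
  obtain ⟨T₀, hT₀, hgT₀⟩ := Multiset.mem_join.1 hg
  have h20 := IsPiece.two_le_card c (hTs T₀ hT₀).1 hgT₀ hg0
  -- the other pieces are inserted into an ordering of a longest one
  obtain ⟨T₁, hT₁, hmax⟩ : ∃ T₁ ∈ Ts, ∀ T ∈ Ts, T.card ≤ T₁.card := by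
    obtain ⟨T₁, h1, h2⟩ := Finset.exists_max_image Ts.toFinset Multiset.card
      ⟨T₀, Multiset.mem_toFinset.2 hT₀⟩
    exact ⟨T₁, Multiset.mem_toFinset.1 h1, fun T hT => h2 T (Multiset.mem_toFinset.2 hT)⟩
  have h2 : 2 ≤ T₁.card := h20.trans (hmax T₀ hT₀)
  have hKh := (hTs T₁ hT₁).2
  obtain ⟨Ts, rfl⟩ := Multiset.exists_cons_of_mem hT₁
  have hmax' : ∀ T ∈ Ts, T.card ≤ T₁.card := fun T hT => hmax T (Multiset.mem_cons_of_mem hT)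
  have hTs' : ∀ T ∈ Ts, c.IsPiece T := fun T hT => (hTs T (Multiset.mem_cons_of_mem hT)).1
  have hsc : ∀ J : Multiset (Multiset G), J.sum.card = (J.map Multiset.card).sum := fun J => by
    simpa using map_multiset_sum (Multiset.cardHom : Multiset G →+ ℕ) J
  have hw : ∀ J : Multiset (Multiset G), (J.map fun T => T.card + (T₁.card - 1)).sum =
      J.sum.card + J.card * (T₁.card - 1) := fun J => by
    rw [Multiset.sum_map_add, hsc]; simp
  rw [Multiset.sum_cons, Multiset.card_add] at hTc
  obtain ⟨J, hJ, hJge, hJmin⟩ := Multiset.exists_minimal_sum_ge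
    (fun T : Multiset G => T.card + (T₁.card - 1)) (2 * k * p) Ts (by
    rw [hw]
    have hA : Ts.sum.card ≤ Ts.card * T₁.card := by
      rw [hsc]
      simpa using Multiset.sum_le_card_nsmul (Ts.map Multiset.card) T₁.card (by
        intro x hx
        obtain ⟨T, hT, rfl⟩ := Multiset.mem_map.1 hx
        exact hmax' T hT)
    by_cases hk1 : k = 1
    · subst hk1
      obtain ⟨d, hd⟩ := Nat.exists_eq_add_of_le hKh
      obtain ⟨K, hK⟩ := Nat.exists_eq_add_of_le h2
      have hA2 : 3 * h + 3 ≤ Ts.sum.card + T₁.card := by omega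
      rw [show T₁.card - 1 = K + 1 by omega]
      rw [hK] at hA hA2
      by_contra hlt
      push Not at hlt
      have hp : p = 2 * (2 + K + d) - 1 := by omega
      have hlt' : Ts.sum.card + Ts.card * (K + 1) + 1 ≤ 2 * (2 * (2 + K + d) - 1) := by
        rw [← hp]; omega
      have hlt2 : Ts.sum.card + Ts.card * (K + 1) + 1 ≤ 4 * (K + d) + 6 := by omega
      have hA3 : 2 * K + 3 * d + 7 ≤ Ts.sum.card := by omega
      generalize Ts.sum.card = A at *
      generalize Ts.card = w at *
      nlinarith [Nat.mul_le_mul_right (2 * K + 3) hA3, Nat.mul_le_mul_right (K + 2) hlt2,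
        Nat.mul_le_mul_right (K + 1) hA, Nat.zero_le (d * K)]
    · have : 2 * p ≤ k * p := Nat.mul_le_mul_right p (by omega)
      omega)
  rw [hw] at hJge
  have hJsum : J.sum ≤ Ts.sum := by
    obtain ⟨J', rfl⟩ := Multiset.le_iff_exists_add.1 hJ
    rw [Multiset.sum_add]; exact Multiset.le_add_right _ _
  have hp2 : p = 2 * h - 1 := by omega
  have hshortU := Multiset.add_sum_le_of_minimal hk h2 hKh (J.map Multiset.card)
    (by
      intro x hx
      obtain ⟨T, hT, rfl⟩ := Multiset.mem_map.1 hx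
      exact hmax' T (Multiset.mem_of_le hJ hT))
    (by rw [← hsc, Multiset.card_map, ← hp2]; exact hJge)
    (by
      intro x hx
      obtain ⟨T, hT, rfl⟩ := Multiset.mem_map.1 hx
      obtain ⟨J', rfl⟩ := Multiset.exists_cons_of_mem hT
      have := hJmin T J' rfl
      rw [hw] at this
      rw [← hsc, Multiset.card_map, ← hp2, Multiset.sum_cons, Multiset.card_add,
        Multiset.card_cons, add_mul, one_mul]
      omega)
  rw [← hsc, ← hp2] at hshortU
  rw [Multiset.sum_cons] at hTS
  have hle1 : T₁ + J.sum ≤ S := (add_le_add le_rfl hJsum).trans hTS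
  obtain ⟨l, rfl⟩ : ∃ l : List G, (l : Multiset G) = T₁ := ⟨T₁.toList, by simp⟩
  have hp1 := (hTs _ hT₁).1
  have hK := IsPiece.card_le_prefixes c hp1
  have hfull := c.subreach_card ⟨0, c.zero_mem_prefixes l⟩ (c.one_le_subreach l) J
    (fun T hT => hTs' T (Multiset.mem_of_le hJ hT)) (fun T hT => by
      have hT' := hTs' T (Multiset.mem_of_le hJ hT)
      exact hshort T (((Multiset.single_le_sum (by simp) T hT).trans
        (Multiset.le_add_left _ _)).trans hle1) hT'.ne_zero (IsPiece.card_le c hT') hT'.label_eq)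
  have hsum : (J.map fun T => T.card + ((l : Multiset G).card - 1)).sum ≤
      (J.map fun T => min p ((c.prefixes l).ncard + T.card - 1)).sum := by
    apply Multiset.sum_map_le_sum_map
    intro T hT
    have := hmax' T (Multiset.mem_of_le hJ hT)
    rw [Multiset.coe_card] at *
    omega
  rw [hw] at hsum
  obtain ⟨U, rfl, W, hW, hWl, hv⟩ := mem_of_min_le_ncard hfull (by omega) 0
  have hWc := Multiset.card_le_card hW
  have hle : (l : Multiset G) + W ≤ S := (add_le_add le_rfl hW).trans hle1
  refine c.false_of_card_lt hp3 hq hS hcard hshort hle (by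
    intro h
    have := congrArg Multiset.card h
    rw [Multiset.card_add] at this
    simp only [Multiset.card_zero] at this; omega) (by rw [Multiset.card_add]; omega)
    (by rw [c.label_add, hWl, hp1.label_eq, add_zero]) (c.reach_subset_vals _ _ hv) ?_
  by_contra hcon
  push Not at hcon
  have h1 : S - (l + W) ≤ S.filter fun g => c.ℓ g = 0 :=
    Multiset.le_filter.2 ⟨Multiset.sub_le_self _ _, hcon⟩
  have h3 := Multiset.card_le_card h1
  rw [Multiset.card_sub hle, Multiset.card_add] at h3
  omega

/-! ### Sequences with exactly two terms outside the normal subgroup -/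

theorem ext_coord [Fact q.Prime] {g h : G} (hℓ : c.ℓ g = c.ℓ h) (hβ : c.β g = c.β h) : g = h := by
  have h1 := c.ℓ_mul g (g⁻¹ * h)
  have h2 := c.β_mul g (g⁻¹ * h)
  rw [mul_inv_cancel_left] at h1 h2
  have h3 : c.ℓ (g⁻¹ * h) = 0 := by
    rw [hℓ] at h1
    exact left_eq_add.1 h1
  have h4 : c.β (g⁻¹ * h) = 0 := by
    rw [hβ] at h2
    exact (mul_eq_zero.1 (left_eq_add.1 h2)).resolve_left (c.χ_ne_zero _)
  exact inv_mul_eq_one.1 (c.eq_one _ h3 h4)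

open Classical in
/-- A minimal product-one sequence of length `2 * q` has exactly two terms outside the normal subgroup
of order `q`. -/
theorem card_label_ne_zero [Fact p.Prime] [Fact q.Prime] (hodd : Odd p) {k : ℕ} (hk : 1 ≤ k)
    (hq : q = 2 * k * p + 1) {S : Multiset G} (hS : IsMinimalProductOne S)
    (hcard : S.card = 2 * q) : (S.filter fun g => ¬ c.ℓ g = 0).card = 2 := by
  have hp2 := (Fact.out : p.Prime).two_le
  have hp3 : 3 ≤ p := by
    obtain ⟨j, hj⟩ := hodd; omega
  have e1 : 2 * k * p = 2 * (k * p) := by ring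
  have e2 : 3 * k * p = 3 * (k * p) := by ring
  have hkp : p ≤ k * p := Nat.le_mul_of_pos_left p hk
  have h1S := hS.one_notMem (by omega)
  have hb : ∀ g ∈ S, c.ℓ g = 0 → c.β g ≠ 0 := fun g hg h0 h1 =>
    h1S (c.eq_one g h0 h1 ▸ hg)
  obtain ⟨X, hXdef⟩ : ∃ X, X = S.filter fun g => ¬ c.ℓ g = 0 := ⟨_, rfl⟩
  obtain ⟨Y, hYdef⟩ : ∃ Y, Y = S.filter fun g => c.ℓ g = 0 := ⟨_, rfl⟩
  have hXY : X + Y = S := by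
    rw [hXdef, hYdef, add_comm]; exact Multiset.filter_add_not _ _
  have hX : ∀ g ∈ X, c.ℓ g ≠ 0 := by
    intro g hg
    rw [hXdef] at hg
    exact (Multiset.mem_filter.1 hg).2
  have hY : ∀ g ∈ Y, c.ℓ g = 0 := by
    intro g hg
    rw [hYdef] at hg
    exact (Multiset.mem_filter.1 hg).2
  have hbY : ∀ g ∈ Y, c.β g ≠ 0 := by
    intro g hg
    rw [hYdef] at hg
    exact hb g (Multiset.mem_filter.1 hg).1 (Multiset.mem_filter.1 hg).2
  have hc : X.card + Y.card = 2 * q := by rw [← Multiset.card_add, hXY, hcard]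
  rw [← hXdef]
  have hSXY : IsMinimalProductOne (X + Y) := hXY.symm ▸ hS
  have hXl := c.label_eq_zero_of_minimal hSXY hY
  by_contra hne
  rcases Nat.lt_or_ge X.card 3 with hlt | h3
  · have hX01 : X.card = 0 ∨ X.card = 1 := by omega
    rcases hX01 with h0 | h1
    · rw [Multiset.card_eq_zero] at h0
      rw [h0, zero_add] at hSXY
      rw [h0, Multiset.card_zero, zero_add] at hc
      obtain ⟨U, hU, hU0, hUc, hv⟩ := c.exists_zero_sum_normal hY (by omega)
      refine c.not_split hSXY hU hU0 (by omega)
        (c.label_of_label_zero fun g hg => hY g (Multiset.mem_of_le hU hg)) hv ?_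
      have hYv := ((c.isProductOne_iff _).1 hSXY.1).2
      rw [c.vals_of_label_zero hY, Set.mem_singleton_iff] at hYv
      rw [c.vals_of_label_zero fun g hg => hY g (Multiset.mem_of_le hU hg),
        Set.mem_singleton_iff] at hv
      rw [c.vals_of_label_zero fun g hg =>
        hY g (Multiset.mem_of_le (Multiset.sub_le_self _ _) hg), Set.mem_singleton_iff]
      have : ((Y - U + U).map c.β).sum = 0 := by rw [Multiset.sub_add_cancel hU, ← hYv]
      rw [Multiset.map_add, Multiset.sum_add, ← hv, add_zero] at this
      exact this.symm
    · obtain ⟨g, hg⟩ := Multiset.card_eq_one.1 h1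
      rw [hg, c.label_singleton] at hXl
      exact hX g (by simp [hg]) hXl
  · obtain ⟨T, hT, hTp⟩ := c.exists_piece_le (R := X)
      (by rintro rfl; simp at h3) hXl
    by_cases hTX : T = X
    · subst hTX
      exact c.false_of_isPiece hSXY hX hY hbY (by omega) hTp h3 hc
    by_cases hdom : 3 * (q - 1) ≤ 2 * Y.card
    · exact c.false_of_normal_dominated hSXY hX hY hbY ⟨k * p, by omega⟩ hT hTp.ne_zero hTX
        hTp.label_eq hdom
    by_cases hs : ∃ U ≤ S, U ≠ 0 ∧ U.card ≤ p ∧ c.label U = 0 ∧ (0 : ZMod q) ∈ c.vals U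
    · obtain ⟨U, hU, hU0, hUp, hUl, hUv⟩ := hs
      exact c.false_of_short hp3 hk hq hS hb hcard (by rw [← hYdef]; omega) hU hU0 hUp hUl hUv
    have hshort : ∀ T ≤ S, T ≠ 0 → T.card ≤ p → c.label T = 0 → (0 : ZMod q) ∉ c.vals T :=
      fun T h1 h2 h3 h4 h5 => hs ⟨T, h1, h2, h3, h4, h5⟩
    by_cases hhalf : k * p ≤ Y.card
    · exact c.false_of_normal_half hp3 hk hq hSXY hX hY hbY hT hTp hTX hc (by omega)
        (hXY.symm ▸ hshort)
    · exact c.false_of_normal_lt hp3 hk hodd hq hS hcard (by rw [← hYdef]; omega) hshort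

/-- If exactly two terms lie outside the normal subgroup, the others coincide: a zero-sum
subsequence of them has length at least `q`, since its complement attains every value. -/
theorem eq_of_label_zero [Fact p.Prime] [Fact q.Prime] {X Y : Multiset G}
    (hS : IsMinimalProductOne (X + Y)) (hX : ∀ g ∈ X, c.ℓ g ≠ 0) (hY : ∀ y ∈ Y, c.ℓ y = 0)
    (hb : ∀ y ∈ Y, c.β y ≠ 0) (hX2 : X.card = 2) (hYc : Y.card + 2 = 2 * q)
    {y y' : G} (hy : y ∈ Y) (hy' : y' ∈ Y) : y = y' := by
  classical
  have hq2 := (Fact.out : q.Prime).two_le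
  by_contra hne
  have hpair : ({y, y'} : Multiset G) ≤ Y := by
    rw [Multiset.le_iff_subset (by simpa using hne)]
    intro g hg
    simp only [Multiset.insert_eq_cons, Multiset.mem_cons, Multiset.mem_singleton] at hg
    rcases hg with rfl | rfl <;> assumption
  have hYp : (Y - {y, y'}).card + 2 = Y.card := by
    rw [Multiset.card_sub hpair]
    have := Multiset.card_le_card hpair
    simp at this ⊢; omega
  obtain ⟨Z, hZ, hZc⟩ := Multiset.exists_le_card_eq (n := q - 2) (S := Y - {y, y'}) (by omega)
  have hsum : ((({y, y'} : Multiset G) :: (Z.map fun y => ({y} : Multiset G)).toList)).sum =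
      {y, y'} + Z := by
    rw [List.sum_cons, ← Multiset.sum_coe, Multiset.coe_toList, Multiset.sum_map_singleton]
  obtain ⟨T, hT0, hT, hTc, hTs⟩ := exists_zero_sum_selection c.β
    (({y, y'} : Multiset G) :: (Z.map fun y => ({y} : Multiset G)).toList) (by
      intro B hB
      rcases List.mem_cons.1 hB with rfl | hB
      · have : c.β y ≠ c.β y' := fun h => hne (c.ext_coord ((hY y hy).trans (hY y' hy').symm) h)
        simpa using this
      · rw [Multiset.mem_toList, Multiset.mem_map] at hB
        obtain ⟨y, -, rfl⟩ := hB
        simp) (by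
      rw [hsum, Multiset.card_add, hZc]; simp; omega)
  rw [hsum] at hT
  have hTY : T ≤ Y := hT.trans (by
    rw [← add_tsub_cancel_of_le hpair]; exact add_le_add le_rfl hZ)
  have hTY0 : ∀ g ∈ T, c.ℓ g = 0 := fun g hg => hY g (Multiset.mem_of_le hTY hg)
  have hTc' : T.card + 1 ≤ q := by
    simp [hZc] at hTc
    omega
  have hTYc := Multiset.card_le_card hTY
  have hR : X + Y - T = X + (Y - T) := by
    ext g
    simp only [Multiset.count_sub, Multiset.count_add]
    have := Multiset.count_le_of_le g hTY
    omega
  refine c.not_split hS (hTY.trans (Multiset.le_add_left _ _)) hT0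
    (by rw [Multiset.card_add]; omega) (c.label_of_label_zero hTY0)
    (by rw [c.vals_of_label_zero hTY0, hTs]; rfl) ?_
  rw [hR]
  apply c.mem_vals_of_normal
  · rintro rfl
    simp at hX2
  · exact hX
  · exact fun g hg => hY g (Multiset.mem_of_le (Multiset.sub_le_self _ _) hg)
  · exact fun g hg => hb g (Multiset.mem_of_le (Multiset.sub_le_self _ _) hg)
  · rw [Multiset.card_sub hTY]; omega

/-- A product-one sequence `x · x' · y^[n]` has an ordering that starts with `x`. -/
theorem _root_.IsProductOne.exists_pow_pow {G : Type*} [Group G] {x x' y : G} {n : ℕ}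
    (h : IsProductOne ({x} + {x'} + Multiset.replicate n y)) :
    ∃ a b, a + b = n ∧ x * y ^ a * x' * y ^ b = 1 := by
  obtain ⟨l, hl, hprod⟩ := h
  have hx : x ∈ l := by rw [← Multiset.mem_coe, hl]; simp
  obtain ⟨u, v, rfl⟩ := List.append_of_mem hx
  have hvu : ((v ++ u : List G) : Multiset G) = {x'} + Multiset.replicate n y := by
    rw [← Multiset.coe_add, ← Multiset.cons_coe, Multiset.add_cons, add_assoc,
      Multiset.singleton_add, Multiset.cons_inj_right] at hl
    rw [← Multiset.coe_add, add_comm, hl]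
  have hp1 : x * (v ++ u).prod = 1 := by
    rw [List.prod_append, List.prod_cons] at hprod
    rw [List.prod_append, ← mul_assoc, mul_eq_one_comm]
    exact hprod
  have hx' : x' ∈ v ++ u := by rw [← Multiset.mem_coe, hvu]; simp
  obtain ⟨w, z, hwz⟩ := List.append_of_mem hx'
  rw [hwz] at hvu hp1
  rw [← Multiset.coe_add, ← Multiset.cons_coe, Multiset.add_cons,
      Multiset.singleton_add, Multiset.cons_inj_right] at hvu
  have hall : ∀ g, g ∈ w ∨ g ∈ z → g = y := by
    intro g hg
    refine Multiset.eq_of_mem_replicate (n := n) ?_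
    rw [← hvu, Multiset.mem_add, Multiset.mem_coe, Multiset.mem_coe]
    exact hg
  refine ⟨w.length, z.length, ?_, ?_⟩
  · simpa using congrArg Multiset.card hvu
  · rw [List.prod_append, List.prod_cons,
      List.eq_replicate_of_mem (fun g hg => hall g (Or.inl hg)),
      List.eq_replicate_of_mem (fun g hg => hall g (Or.inr hg)),
      List.prod_replicate, List.prod_replicate] at hp1
    simpa [mul_assoc] using hp1

theorem ℓ_pow (g : G) (n : ℕ) : c.ℓ (g ^ n) = n * c.ℓ g := by
  induction n with
  | zero => simp [c.ℓ_one]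
  | succ n ih => rw [pow_succ, c.ℓ_mul, ih]; push_cast; ring

theorem β_pow_of_ℓ_eq_zero {y : G} (hy : c.ℓ y = 0) (n : ℕ) : c.β (y ^ n) = n * c.β y := by
  induction n with
  | zero => simp [c.β_one]
  | succ n ih =>
    rw [pow_succ, c.β_mul, ih, c.ℓ_pow, hy, mul_zero, c.χ_zero]
    push_cast
    ring

theorem pow_eq_one {y : G} (hy : c.ℓ y = 0) : y ^ q = 1 :=
  c.eq_one _ (by rw [c.ℓ_pow, hy, mul_zero]) (by rw [c.β_pow_of_ℓ_eq_zero hy]; simp)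

/-- In a product-one ordering `x y ^ a x' y ^ b` with `a + b = 2 * q - 2` both exponents are `q - 1`,
since otherwise `q` copies of `y` split off; this determines `x'`. -/
theorem exists_eq_replicate [Fact p.Prime] [Fact q.Prime] (hodd : Odd p) {k : ℕ} (hk : 1 ≤ k)
    (hq : q = 2 * k * p + 1) {S : Multiset G} (hS : IsMinimalProductOne S)
    (hcard : S.card = 2 * q) :
    ∃ x y : G, c.ℓ x ≠ 0 ∧ c.ℓ y = 0 ∧ c.β y ≠ 0 ∧
      S = {x} + {y * x⁻¹ * y} + Multiset.replicate (2 * q - 2) y := by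
  classical
  have hq2 := (Fact.out : q.Prime).two_le
  have h2 := c.card_label_ne_zero hodd hk hq hS hcard
  have h1S := hS.one_notMem (by omega)
  obtain ⟨x, x', hxx⟩ := Multiset.card_eq_two.1 h2
  obtain ⟨Y, hYdef⟩ : ∃ Y, Y = S.filter fun g => c.ℓ g = 0 := ⟨_, rfl⟩
  have hXY : {x} + {x'} + Y = S := by
    have : ({x} + {x'} : Multiset G) = {x, x'} := rfl
    rw [this, ← hxx, hYdef, add_comm]; exact Multiset.filter_add_not _ _
  have hX : ∀ g ∈ ({x} + {x'} : Multiset G), c.ℓ g ≠ 0 := by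
    intro g hg
    have : ({x} + {x'} : Multiset G) = {x, x'} := rfl
    rw [this, ← hxx] at hg
    exact (Multiset.mem_filter.1 hg).2
  have hY : ∀ g ∈ Y, c.ℓ g = 0 := by
    intro g hg
    rw [hYdef] at hg
    exact (Multiset.mem_filter.1 hg).2
  have hbY : ∀ g ∈ Y, c.β g ≠ 0 := by
    intro g hg h1
    rw [hYdef, Multiset.mem_filter] at hg
    exact h1S (c.eq_one g hg.2 h1 ▸ hg.1)
  have hYc : Y.card + 2 = 2 * q := by
    rw [← hcard, ← hXY]; simp
  rw [← hXY] at hS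
  obtain ⟨y, hy⟩ : ∃ y, y ∈ Y := Multiset.card_pos_iff_exists_mem.1 (by omega)
  have hYrep : Y = Multiset.replicate (2 * q - 2) y := Multiset.eq_replicate.2
    ⟨by omega, fun g hg => c.eq_of_label_zero hS hX hY hbY (by simp) hYc hg hy⟩
  rw [hYrep] at hS hXY
  have hyq := c.pow_eq_one (hY y hy)
  obtain ⟨a, b, hab, hprod⟩ := hS.1.exists_pow_pow
  -- otherwise `q` copies of `y` could be removed from the ordering
  have ha : a % q = q - 1 := by
    by_contra hne
    have hlt := Nat.mod_lt a (show 0 < q by omega)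
    refine hS.2 ({x} + {x'} + Multiset.replicate (q - 2) y) (Multiset.replicate q y) (by simp)
      (by rw [← Multiset.card_pos, Multiset.card_replicate]; omega) ?_ ⟨List.replicate q y, rfl, by simpa⟩ ?_
    · refine ⟨[x] ++ List.replicate (a % q) y ++ [x'] ++ List.replicate (q - 2 - a % q) y, ?_, ?_⟩
      · rw [show q - 2 = a % q + (q - 2 - a % q) by omega, Multiset.replicate_add]
        simp only [← Multiset.coe_add, Multiset.coe_singleton, Multiset.coe_replicate]
        rw [show a % q + (q - 2 - a % q) - a % q = q - 2 - a % q by omega]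
        abel
      · have e1 : y ^ (a % q) = y ^ a := pow_eq_pow_of_modEq (Nat.mod_modEq _ _) hyq
        have e2 : y ^ (q - 2 - a % q) = y ^ b := by
          refine pow_eq_pow_of_modEq ?_ hyq
          refine Nat.ModEq.add_left_cancel (Nat.mod_modEq a q) ?_
          rw [hab, show a % q + (q - 2 - a % q) = q - 2 by omega,
            show 2 * q - 2 = q - 2 + q by omega]
          exact (Nat.add_mod_right _ _).symm
        simp only [List.prod_append, List.prod_singleton, List.prod_replicate, e1, e2]
        exact hprod
    · rw [show 2 * q - 2 = q - 2 + q by omega, Multiset.replicate_add, ← add_assoc]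
  have ha' : a = q - 1 := by
    have := Nat.div_add_mod a q
    rcases Nat.eq_zero_or_pos (a / q) with h | h
    · rw [h] at this; omega
    · have := Nat.le_mul_of_pos_right q h
      omega
  have hb' : b = q - 1 := by omega
  have hyinv : y ^ (q - 1) = y⁻¹ := by
    rw [eq_inv_iff_mul_eq_one, ← pow_succ, Nat.sub_add_cancel (by omega), hyq]
  rw [ha', hb', hyinv] at hprod
  have hx' : x' = y * x⁻¹ * y := by
    rw [mul_inv_eq_one] at hprod
    rw [eq_inv_mul_of_mul_eq hprod]; group
  rw [hx'] at hXY
  exact ⟨x, y, hX x (by simp), hY y hy, hbY y hy, hXY.symm⟩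

end AffineCoord

/-! ### Standard generators and the presentation -/

/-- Elements `x` of order `p` and `y` of order `q` with `y * x = x * y ^ s`, where `s` has
multiplicative order `p` modulo `q`. -/
structure IsStandardPair {G : Type*} [Group G] (p q s : ℕ) (x y : G) : Prop where
  orderOf_left : orderOf x = p
  orderOf_right : orderOf y = q
  rel : y * x = x * y ^ s
  orderOf_exponent : orderOf (s : ZMod q) = p

theorem pow_mul_pow_of_rel {G : Type*} [Group G] {x y : G} {s : ℕ} (h : y * x = x * y ^ s)
    (i j : ℕ) : y ^ j * x ^ i = x ^ i * y ^ (j * s ^ i) := by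
  have h1 : ∀ j, y ^ j * x = x * y ^ (j * s) := by
    intro j
    have : SemiconjBy x (y ^ s) y := h.symm
    rw [mul_comm, pow_mul]
    exact ((this.pow_right j).eq).symm
  induction i with
  | zero => simp
  | succ i ih =>
    rw [pow_succ, ← mul_assoc, ih, mul_assoc, h1, pow_succ s, mul_assoc j, mul_assoc]

/-- Subgroups of coprime orders `q` and `p` are complements in a group of order `p * q`. -/
theorem bijective_pow_mul_pow {G : Type*} [Group G] {p q : ℕ} [Fact p.Prime] [Fact q.Prime]
    (hlt : p < q) (hcard : Nat.card G = p * q) {x y : G} (hx : orderOf x = p)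
    (hy : orderOf y = q) :
    Function.Bijective fun a : ZMod q × ZMod p => y ^ a.1.val * x ^ a.2.val := by
  have hp := (Fact.out : p.Prime)
  have hq := (Fact.out : q.Prime)
  have : Finite G := Nat.finite_of_card_ne_zero (by
    rw [hcard]; exact mul_ne_zero hp.ne_zero hq.ne_zero)
  have hcop : q.Coprime p := ((Nat.coprime_primes hp hq).2 hlt.ne).symm
  have hcompl : (Subgroup.zpowers y).IsComplement' (Subgroup.zpowers x) :=
    Subgroup.isComplement'_of_coprime
      (by rw [Nat.card_zpowers, Nat.card_zpowers, hx, hy, hcard, mul_comm])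
      (by rwa [Nat.card_zpowers, Nat.card_zpowers, hx, hy])
  refine Function.Injective.bijective_of_nat_card_le ?_ (by
    rw [hcard, Nat.card_prod, Nat.card_zmod, Nat.card_zmod, mul_comm])
  rintro ⟨j, i⟩ ⟨j', i'⟩ h
  have hinj := hcompl.1
    (a₁ := (⟨y ^ j.val, Subgroup.npow_mem_zpowers y _⟩, ⟨x ^ i.val, Subgroup.npow_mem_zpowers x _⟩))
    (a₂ := (⟨y ^ j'.val, Subgroup.npow_mem_zpowers y _⟩,
      ⟨x ^ i'.val, Subgroup.npow_mem_zpowers x _⟩)) h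
  simp only [Prod.mk.injEq, Subtype.mk.injEq] at hinj
  rw [pow_inj_mod, pow_inj_mod, hx, hy, Nat.mod_eq_of_lt (ZMod.val_lt j),
    Nat.mod_eq_of_lt (ZMod.val_lt j'), Nat.mod_eq_of_lt (ZMod.val_lt i),
    Nat.mod_eq_of_lt (ZMod.val_lt i')] at hinj
  exact Prod.ext (ZMod.val_injective q hinj.1) (ZMod.val_injective p hinj.2)

theorem of_zero_pow_eq_one (p q s : ℕ) :
    (PresentedGroup.of 0 : PresentedGroup (metacyclicRelators p q s)) ^ p = 1 :=
  (map_pow (PresentedGroup.mk _) _ _).symm.trans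
    (PresentedGroup.one_of_mem (by simp [metacyclicRelators]))

theorem of_one_pow_eq_one (p q s : ℕ) :
    (PresentedGroup.of 1 : PresentedGroup (metacyclicRelators p q s)) ^ q = 1 :=
  (map_pow (PresentedGroup.mk _) _ _).symm.trans
    (PresentedGroup.one_of_mem (by simp [metacyclicRelators]))

theorem of_one_mul_of_zero (p q s : ℕ) :
    (PresentedGroup.of 1 : PresentedGroup (metacyclicRelators p q s)) * PresentedGroup.of 0 =
      PresentedGroup.of 0 * PresentedGroup.of 1 ^ s := by
  have h := PresentedGroup.mk_eq_mk_of_mul_inv_mem (rels := metacyclicRelators p q s)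
    (x := FreeGroup.of 1 * FreeGroup.of 0) (y := FreeGroup.of 0 * FreeGroup.of 1 ^ s)
    (by simp [metacyclicRelators])
  rw [map_mul, map_mul, map_pow] at h
  exact h

namespace IsStandardPair

variable {G : Type*} [Group G] {p q s : ℕ} {x y : G}

/-- The last term of the extremal sequence, which is the solution of `x * y⁻¹ * z * y⁻¹ = 1`. -/
theorem conj_inv [Fact p.Prime] (h : IsStandardPair p q s x y) :
    y * x⁻¹ * y = x ^ (p - 1) * y ^ (s ^ (p - 1) + 1) := by
  have hp := (Fact.out : p.Prime)
  have hxi : x ^ (p - 1) = x⁻¹ := by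
    rw [eq_inv_iff_mul_eq_one, ← pow_succ, Nat.sub_add_cancel hp.one_le, ← h.orderOf_left,
      pow_orderOf_eq_one]
  have := pow_mul_pow_of_rel h.rel (p - 1) 1
  rw [pow_one, one_mul, hxi] at this
  rw [this, hxi, pow_succ, mul_assoc]

theorem exists_affineCoord [Fact p.Prime] [Fact q.Prime] (h : IsStandardPair p q s x y)
    (hlt : p < q) (hcard : Nat.card G = p * q) :
    ∃ c : AffineCoord p q G, c.ℓ x = 1 ∧ c.ℓ y = 0 ∧ c.β y = 1 := by
  have hp := (Fact.out : p.Prime)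
  have hq := (Fact.out : q.Prime)
  have hbij := bijective_pow_mul_pow hlt hcard h.orderOf_left h.orderOf_right
  have hxp : x ^ p = 1 := by rw [← h.orderOf_left, pow_orderOf_eq_one]
  have hyq : y ^ q = 1 := by rw [← h.orderOf_right, pow_orderOf_eq_one]
  have hsp : (s : ZMod q) ^ p = 1 := by
    conv_lhs => rw [← h.orderOf_exponent]
    exact pow_orderOf_eq_one _
  have hs0 : (s : ZMod q) ≠ 0 := by
    intro h0
    rw [h0, zero_pow hp.ne_zero] at hsp
    exact zero_ne_one hsp
  -- conjugation by `x` raises `y` to the power `s⁻¹`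
  have hr : ((s : ZMod q)⁻¹) ^ p = 1 := by rw [inv_pow, hsp, inv_one]
  have hro : orderOf (s : ZMod q)⁻¹ = p := by
    refine orderOf_eq_prime hr fun h1 => hp.one_lt.ne ?_
    rw [← h.orderOf_exponent, inv_eq_one.1 h1, orderOf_one]
  have hyc : ∀ m n : ℕ, (m : ZMod q) = n → y ^ m = y ^ n := fun m n hmn =>
    pow_eq_pow_of_modEq ((ZMod.natCast_eq_natCast_iff _ _ _).1 hmn) hyq
  have hxc : ∀ m n : ℕ, (m : ZMod p) = n → x ^ m = x ^ n := fun m n hmn =>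
    pow_eq_pow_of_modEq ((ZMod.natCast_eq_natCast_iff _ _ _).1 hmn) hxp
  let e := Equiv.ofBijective _ hbij
  have he : ∀ a, e a = y ^ a.1.val * x ^ a.2.val := fun a => rfl
  let χ : AddChar (ZMod p) (ZMod q) := AddChar.zmodChar p hr
  have hχ : ∀ i, χ i = (s : ZMod q)⁻¹ ^ i.val := fun i => AddChar.zmodChar_apply hr i
  have hmul : ∀ a b : ZMod q × ZMod p, e a * e b = e (a.1 + χ a.2 * b.1, a.2 + b.2) := by
    rintro ⟨j, i⟩ ⟨j', i'⟩
    simp only [he]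
    have h1 : x ^ i.val * y ^ j'.val = y ^ (χ i * j').val * x ^ i.val := by
      rw [pow_mul_pow_of_rel h.rel]
      congr 1
      apply hyc
      push_cast
      rw [ZMod.natCast_zmod_val, ZMod.natCast_zmod_val, hχ, mul_right_comm, ← mul_pow,
        inv_mul_cancel₀ hs0, one_pow, one_mul]
    have h2 : y ^ (j + χ i * j').val = y ^ j.val * y ^ (χ i * j').val := by
      rw [← pow_add]
      apply hyc
      push_cast
      simp only [ZMod.natCast_zmod_val]
    have h3 : x ^ (i + i').val = x ^ i.val * x ^ i'.val := by
      rw [← pow_add]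
      apply hxc
      push_cast
      simp only [ZMod.natCast_zmod_val]
    rw [h2, h3, mul_assoc, ← mul_assoc (x ^ i.val), h1]
    simp only [mul_assoc]
  have hsymm : ∀ g h, e.symm (g * h) =
      ((e.symm g).1 + χ (e.symm g).2 * (e.symm h).1, (e.symm g).2 + (e.symm h).2) := by
    intro g h
    rw [Equiv.symm_apply_eq, ← hmul, e.apply_symm_apply, e.apply_symm_apply]
  have : Fact (1 < p) := ⟨hp.one_lt⟩
  have : Fact (1 < q) := ⟨hq.one_lt⟩
  have hex : e.symm x = (0, 1) := by
    rw [Equiv.symm_apply_eq, he]; simp [ZMod.val_one]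
  have hey : e.symm y = (1, 0) := by
    rw [Equiv.symm_apply_eq, he]; simp [ZMod.val_one]
  refine ⟨⟨χ, ?_, fun g => (e.symm g).2, fun g => (e.symm g).1, ?_, ?_, ?_⟩, ?_, ?_, ?_⟩
  · intro i j hij
    rw [hχ, hχ] at hij
    refine ZMod.val_injective p (pow_injOn_Iio_orderOf ?_ ?_ hij)
    · rw [hro]; exact ZMod.val_lt i
    · rw [hro]; exact ZMod.val_lt j
  · exact fun g h => by rw [hsymm]
  · exact fun g h => by rw [hsymm]
  · intro g h0 h1
    have : e.symm g = (0, 0) := Prod.ext h1 h0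
    rw [Equiv.symm_apply_eq, he] at this
    simpa using this
  · simp [hex]
  · simp [hey]
  · simp [hey]

/-- The map from the presented group is onto, and it is injective since the words `x ^ i * y ^ j`
exhaust the presented group. -/
theorem hasStandardPresentation [Fact p.Prime] [Fact q.Prime] (h : IsStandardPair p q s x y)
    (hlt : p < q) (hcard : Nat.card G = p * q) : HasStandardPresentation p q s x y := by
  have hp := (Fact.out : p.Prime)
  have hq := (Fact.out : q.Prime)
  have hbij := bijective_pow_mul_pow hlt hcard h.orderOf_left h.orderOf_right
  have hxp : x ^ p = 1 := by rw [← h.orderOf_left, pow_orderOf_eq_one]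
  have hyq : y ^ q = 1 := by rw [← h.orderOf_right, pow_orderOf_eq_one]
  have hrels : ∀ r ∈ metacyclicRelators p q s, FreeGroup.lift ![x, y] r = 1 := by
    rintro r (rfl | rfl | rfl)
    · simpa using hxp
    · simpa using hyq
    · simp [h.rel]
  refine ⟨h.orderOf_exponent, ?_⟩
  let φ := PresentedGroup.toGroup hrels
  have hφ0 : φ (PresentedGroup.of 0) = x := PresentedGroup.toGroup.of hrels
  have hφ1 : φ (PresentedGroup.of 1) = y := PresentedGroup.toGroup.of hrels
  have hsurj : Function.Surjective φ := by
    intro g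
    obtain ⟨⟨j, i⟩, rfl⟩ := hbij.2 g
    exact ⟨PresentedGroup.of 1 ^ j.val * PresentedGroup.of 0 ^ i.val, by simp [hφ0, hφ1]⟩
  have hX := of_zero_pow_eq_one p q s
  have hY := of_one_pow_eq_one p q s
  have hXY := of_one_mul_of_zero p q s
  generalize hXd : (PresentedGroup.of 0 : PresentedGroup (metacyclicRelators p q s)) = X at *
  generalize hYd : (PresentedGroup.of 1 : PresentedGroup (metacyclicRelators p q s)) = Y at *
  have hXi : X⁻¹ = X ^ (p - 1) := by
    rw [inv_eq_iff_mul_eq_one, ← pow_succ', Nat.sub_add_cancel hp.one_le, hX]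
  have hYi : Y⁻¹ = Y ^ (q - 1) := by
    rw [inv_eq_iff_mul_eq_one, ← pow_succ', Nat.sub_add_cancel hq.one_le, hY]
  -- the words `X ^ i * Y ^ j` exhaust the presented group
  let H : Subgroup (PresentedGroup (metacyclicRelators p q s)) :=
    { carrier := {g | ∃ i j : ℕ, g = X ^ i * Y ^ j}
      mul_mem' := by
        rintro _ _ ⟨i, j, rfl⟩ ⟨k, l, rfl⟩
        refine ⟨i + k, j * s ^ k + l, ?_⟩
        rw [mul_assoc, ← mul_assoc (Y ^ j), pow_mul_pow_of_rel hXY, pow_add, pow_add]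
        simp only [mul_assoc]
      one_mem' := ⟨0, 0, by simp⟩
      inv_mem' := by
        rintro _ ⟨i, j, rfl⟩
        refine ⟨(p - 1) * i, (q - 1) * j * s ^ ((p - 1) * i), ?_⟩
        rw [mul_inv_rev, ← inv_pow, ← inv_pow, hXi, hYi, ← pow_mul, ← pow_mul,
          pow_mul_pow_of_rel hXY] }
  have hnf : ∀ g, ∃ i j : ℕ, g = X ^ i * Y ^ j := by
    refine PresentedGroup.generated_by _ H fun j => ?_
    fin_cases j
    · exact ⟨1, 0, by simpa using hXd⟩
    · exact ⟨0, 1, by simpa using hYd⟩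
  have hinj : Function.Injective φ := by
    rw [injective_iff_map_eq_one]
    intro g hg
    obtain ⟨i, j, rfl⟩ := hnf g
    rw [map_mul, map_pow, map_pow, hφ0, hφ1] at hg
    obtain ⟨c, hcx, hcy, -⟩ := h.exists_affineCoord hlt hcard
    have hi : p ∣ i := by
      have := c.ℓ_mul (x ^ i) (y ^ j)
      rw [hg, c.ℓ_one, c.ℓ_pow, c.ℓ_pow, hcx, hcy, mul_one, mul_zero, add_zero] at this
      exact (ZMod.natCast_eq_zero_iff _ _).1 this.symm
    obtain ⟨i, rfl⟩ := hi
    rw [pow_mul, hxp, one_pow, one_mul, ← orderOf_dvd_iff_pow_eq_one, h.orderOf_right] at hg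
    obtain ⟨j, rfl⟩ := hg
    rw [pow_mul, hX, pow_mul, hY, one_pow, one_pow, one_mul]
  exact ⟨MulEquiv.ofBijective φ ⟨hinj, hsurj⟩, hφ0, hφ1⟩

end IsStandardPair

theorem HasStandardPresentation.isStandardPair {G : Type*} [Group G] {p q s : ℕ} [Fact p.Prime]
    [Fact q.Prime] {x y : G} (h : HasStandardPresentation p q s x y)
    (hG : ∃ a b : G, a * b ≠ b * a) : IsStandardPair p q s x y := by
  obtain ⟨hs, e, rfl, rfl⟩ := h
  have hX := of_zero_pow_eq_one p q s
  have hY := of_one_pow_eq_one p q s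
  have hXY := of_one_mul_of_zero p q s
  -- commuting generators would make the group abelian
  have hcomm : (PresentedGroup.of 0 : PresentedGroup (metacyclicRelators p q s)) *
      PresentedGroup.of 1 ≠ PresentedGroup.of 1 * PresentedGroup.of 0 := by
    intro hc
    have hcl := Subgroup.isMulCommutative_closure
      (k := Set.range (PresentedGroup.of (rels := metacyclicRelators p q s))) (by
        rintro _ ⟨i, rfl⟩ _ ⟨j, rfl⟩
        fin_cases i <;> fin_cases j <;> simp [hc])
    rw [PresentedGroup.closure_range_of] at hcl
    obtain ⟨a, b, hab⟩ := hG
    refine hab (e.symm.injective ?_)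
    rw [map_mul, map_mul]
    exact congrArg Subtype.val (hcl.is_comm.comm ⟨e.symm a, Subgroup.mem_top _⟩
      ⟨e.symm b, Subgroup.mem_top _⟩)
  refine ⟨?_, ?_, ?_, hs⟩
  · rw [MulEquiv.orderOf_eq]
    exact orderOf_eq_prime hX fun h1 => hcomm (by rw [h1, one_mul, mul_one])
  · rw [MulEquiv.orderOf_eq]
    exact orderOf_eq_prime hY fun h1 => hcomm (by rw [h1, one_mul, mul_one])
  · rw [← map_mul, hXY, map_mul, map_pow]

/-- The Sylow `q`-subgroup is normal, as its index is the smallest prime factor of the order; so `x`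
acts on it by a power map, nontrivially because the group is not abelian. -/
theorem exists_isStandardPair {G : Type*} [Group G] {p q : ℕ} [Fact p.Prime] [Fact q.Prime]
    (hlt : p < q) (hcard : Nat.card G = p * q) (hG : ∃ a b : G, a * b ≠ b * a) :
    ∃ (s : ℕ) (x y : G), IsStandardPair p q s x y := by
  have hp := (Fact.out : p.Prime)
  have hq := (Fact.out : q.Prime)
  have : Finite G := Nat.finite_of_card_ne_zero (by
    rw [hcard]; exact mul_ne_zero hp.ne_zero hq.ne_zero)
  obtain ⟨x, hx⟩ := exists_prime_orderOf_dvd_card' (G := G) p (by simp [hcard])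
  obtain ⟨y, hy⟩ := exists_prime_orderOf_dvd_card' (G := G) q (by simp [hcard])
  have hbij := bijective_pow_mul_pow hlt hcard hx hy
  have hN : (Subgroup.zpowers y).Normal := by
    apply Subgroup.normal_of_index_eq_minFac_card
    have h1 := Subgroup.card_mul_index (Subgroup.zpowers y)
    rw [Nat.card_zpowers, hy, hcard, mul_comm p] at h1
    rw [Nat.eq_of_mul_eq_mul_left hq.pos h1, hcard]
    refine (le_antisymm (Nat.minFac_le_of_dvd hp.two_le (dvd_mul_right p q)) ?_).symm
    have hm := Nat.minFac_prime (n := p * q) (by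
      exact fun h => hp.one_lt.ne' (Nat.eq_one_of_mul_eq_one_right h))
    rcases (hm.dvd_mul).1 (Nat.minFac_dvd (p * q)) with h | h
    · exact ((Nat.prime_dvd_prime_iff_eq hm hp).1 h).ge
    · rw [(Nat.prime_dvd_prime_iff_eq hm hq).1 h]; exact hlt.le
  have hmem := hN.conj_mem y (Subgroup.mem_zpowers y) x⁻¹
  rw [← mem_powers_iff_mem_zpowers] at hmem
  obtain ⟨s, hs⟩ := hmem
  have hrel : y * x = x * y ^ s := by
    have : y ^ s = x⁻¹ * y * x⁻¹⁻¹ := hs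
    rw [this]; group
  refine ⟨s, x, y, hx, hy, hrel, orderOf_eq_prime ?_ ?_⟩
  · have := pow_mul_pow_of_rel hrel p 1
    rw [← hx, pow_orderOf_eq_one, hx, mul_one, one_mul, one_mul, pow_eq_pow_iff_modEq, hy,
      ← ZMod.natCast_eq_natCast_iff] at this
    simpa using this.symm
  · intro h1
    have hs1 : y ^ s = y ^ 1 := by
      rw [pow_eq_pow_iff_modEq, hy, ← ZMod.natCast_eq_natCast_iff, h1, Nat.cast_one]
    have hyx : Commute y x := by rwa [hs1, pow_one] at hrel
    obtain ⟨a, b, hab⟩ := hG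
    obtain ⟨⟨j, i⟩, rfl⟩ := hbij.2 a
    obtain ⟨⟨j', i'⟩, rfl⟩ := hbij.2 b
    refine hab (Commute.mul_left ?_ ?_)
    · exact ((Commute.refl y).pow_pow _ _).mul_right (hyx.pow_pow _ _)
    · exact (hyx.symm.pow_pow _ _).mul_right ((Commute.refl x).pow_pow _ _)

/-! ### The characterization -/

theorem AffineCoord.isStandardPair {G : Type*} [Group G] {p q : ℕ} [Fact p.Prime] [Fact q.Prime]
    (c : AffineCoord p q G) {x y : G} (hx : c.ℓ x ≠ 0) (hy : c.ℓ y = 0) (hb : c.β y ≠ 0) :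
    IsStandardPair p q (c.χ (-c.ℓ x)).val x y := by
  have hxp : c.ℓ (x ^ p) = 0 := by rw [c.ℓ_pow]; simp
  refine ⟨orderOf_eq_prime (c.eq_one _ hxp ?_) ?_, orderOf_eq_prime (c.pow_eq_one hy) ?_,
    c.ext_coord ?_ ?_, orderOf_eq_prime ?_ ?_⟩
  · -- `x` commutes with `x ^ p`, so it fixes its translation part
    have h := congrArg c.β (pow_succ' x p)
    rw [pow_succ, c.β_mul, c.β_mul, hxp, c.χ_zero, one_mul] at h
    have h0 : (1 - c.χ (c.ℓ x)) * c.β (x ^ p) = 0 := by linear_combination h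
    exact (mul_eq_zero.1 h0).resolve_left (c.one_sub_χ_ne_zero hx)
  · rintro rfl
    exact hx c.ℓ_one
  · rintro rfl
    exact hb c.β_one
  · rw [c.ℓ_mul, c.ℓ_mul, c.ℓ_pow, hy, mul_zero, add_comm]
  · rw [c.β_mul, c.β_mul, c.β_pow_of_ℓ_eq_zero hy, hy, c.χ_zero, ZMod.natCast_zmod_val]
    linear_combination (-c.β y) * c.χ_neg_mul (c.ℓ x)
  · rw [ZMod.natCast_zmod_val, ← AddChar.map_nsmul_eq_pow]
    simp [c.χ_zero]
  · rw [ZMod.natCast_zmod_val]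
    exact c.χ_ne_one (neg_ne_zero.2 hx)

theorem Multiset.replicate_add_singleton_add {α : Type*} {q : ℕ} (hq : 1 ≤ q) (x x' y : α) :
    Multiset.replicate (q - 1) y + {x} + Multiset.replicate (q - 1) y + {x'} =
      {x} + {x'} + Multiset.replicate (2 * q - 2) y := by
  rw [show 2 * q - 2 = (q - 1) + (q - 1) by omega, Multiset.replicate_add]
  abel

namespace IsStandardPair

variable {G : Type*} [Group G] {p q s : ℕ} {x y : G}

/-- The extremal sequence is minimal: in a splitting the label forces `x` and `y * x⁻¹ * y` into the
same part, so the other part is `y ^ [q]`, and the first part has no product-one ordering. -/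
theorem isMinimalProductOne [Fact p.Prime] [Fact q.Prime] (h : IsStandardPair p q s x y)
    (hlt : p < q) (hcard : Nat.card G = p * q) :
    IsMinimalProductOne ({x} + {y * x⁻¹ * y} + Multiset.replicate (2 * q - 2) y) := by
  classical
  have hp := (Fact.out : p.Prime)
  have hq := (Fact.out : q.Prime)
  have : Fact (1 < p) := ⟨hp.one_lt⟩
  obtain ⟨c, hcx, hcy, hby⟩ := h.exists_affineCoord hlt hcard
  have hyq : y ^ q = 1 := by rw [← h.orderOf_right, pow_orderOf_eq_one]
  have hyinv : y ^ (q - 1) = y⁻¹ := by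
    rw [eq_inv_iff_mul_eq_one, ← pow_succ, Nat.sub_add_cancel hq.one_le, hyq]
  have hx0 : c.ℓ x ≠ 0 := by rw [hcx]; exact one_ne_zero
  refine ⟨⟨List.replicate (q - 1) y ++ [x] ++ List.replicate (q - 1) y ++ [y * x⁻¹ * y], ?_, ?_⟩,
    ?_⟩
  · rw [← Multiset.replicate_add_singleton_add hq.one_le]
    rfl
  · simp [hyinv, mul_assoc]
  -- a splitting leaves only powers of `y` in the part without `x`
  have key : ∀ T₁ T₂ : Multiset G, x ∈ T₁ → T₂ ≠ 0 → IsProductOne T₁ → IsProductOne T₂ →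
      {x} + {y * x⁻¹ * y} + Multiset.replicate (2 * q - 2) y ≠ T₁ + T₂ := by
    intro T₁ T₂ hx1 h20 h1 h2 heq
    obtain ⟨A, rfl⟩ := Multiset.exists_cons_of_mem hx1
    rw [Multiset.cons_add, add_assoc, Multiset.singleton_add, Multiset.cons_inj_right,
      Multiset.singleton_add] at heq
    have hl1 := ((c.isProductOne_iff _).1 h1).1
    rw [c.label_cons] at hl1
    have hrep : ∀ {B D : Multiset G}, Multiset.replicate (2 * q - 2) y = B + D →
        ∀ g, g ∈ B ∨ g ∈ D → g = y := by
      intro B D hBD g hg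
      refine Multiset.eq_of_mem_replicate (n := 2 * q - 2) ?_
      rw [hBD, Multiset.mem_add]
      exact hg
    have hmem : y * x⁻¹ * y ∈ A + T₂ := by rw [← heq]; exact Multiset.mem_cons_self _ _
    rcases Multiset.mem_add.1 hmem with hA | hT
    · obtain ⟨B, rfl⟩ := Multiset.exists_cons_of_mem hA
      rw [Multiset.cons_add, Multiset.cons_inj_right] at heq
      have hB : B = Multiset.replicate B.card y :=
        Multiset.eq_replicate_card.2 fun g hg => hrep heq g (Or.inl hg)
      have hT2 : T₂ = Multiset.replicate T₂.card y :=
        Multiset.eq_replicate_card.2 fun g hg => hrep heq g (Or.inr hg)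
      have hcards := congrArg Multiset.card heq
      rw [Multiset.card_replicate, Multiset.card_add] at hcards
      have h20' := Multiset.card_pos.2 h20
      -- hence the other part consists of exactly `q` terms
      have hT2q : T₂.card = q := by
        have h2v := ((c.isProductOne_iff _).1 h2).2
        rw [hT2, c.vals_of_label_zero (fun g hg => by
          rw [Multiset.eq_of_mem_replicate hg, hcy]), Set.mem_singleton_iff] at h2v
        rw [Multiset.map_replicate, Multiset.sum_replicate, hby, nsmul_eq_mul, mul_one,
          eq_comm, ZMod.natCast_eq_zero_iff] at h2v
        obtain ⟨m, hm⟩ := h2v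
        rcases Nat.lt_or_ge m 2 with hm2 | hm2
        · interval_cases m <;> omega
        · have := Nat.mul_le_mul_left q hm2
          omega
      have hBq : B.card = q - 2 := by omega
      rw [hB, hBq, ← Multiset.singleton_add, ← Multiset.singleton_add, ← add_assoc] at h1
      obtain ⟨a, b, hab, hprod⟩ := h1.exists_pow_pow
      have hconj : x * y ^ (a + 1) * x⁻¹ * y ^ (b + 1) = 1 := by
        rw [← hprod, pow_succ, pow_succ']; simp only [mul_assoc]
      have hyb : y ^ (b + 1) * y ^ (a + 1) = 1 := by
        rw [← pow_add, show b + 1 + (a + 1) = q by have := hq.two_le; omega, hyq]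
      -- so `x` commutes with a nontrivial power of `y`
      have hcomm : x * y ^ (a + 1) = y ^ (a + 1) * x := by
        rw [eq_inv_of_mul_eq_one_left hyb, mul_inv_eq_one] at hconj
        exact mul_inv_eq_iff_eq_mul.1 hconj
      have hβ := congrArg c.β hcomm
      have hℓa : c.ℓ (y ^ (a + 1)) = 0 := by rw [c.ℓ_pow, hcy, mul_zero]
      rw [c.β_mul, c.β_mul, hℓa, c.χ_zero, one_mul] at hβ
      have h0 : (1 - c.χ (c.ℓ x)) * c.β (y ^ (a + 1)) = 0 := by linear_combination -hβ
      have h1y := c.eq_one _ hℓa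
        ((mul_eq_zero.1 h0).resolve_left (c.one_sub_χ_ne_zero hx0))
      rw [← orderOf_dvd_iff_pow_eq_one, h.orderOf_right] at h1y
      have := Nat.le_of_dvd (by omega) h1y
      have := hq.two_le
      omega
    · obtain ⟨D, rfl⟩ := Multiset.exists_cons_of_mem hT
      rw [Multiset.add_cons, Multiset.cons_inj_right] at heq
      rw [c.label_of_label_zero fun g hg => by rw [hrep heq g (Or.inl hg), hcy], add_zero] at hl1
      exact hx0 hl1
  intro T₁ T₂ h10 h20 h1 h2 heq
  have hx : x ∈ T₁ + T₂ := by rw [← heq]; simp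
  rcases Multiset.mem_add.1 hx with hx | hx
  · exact key T₁ T₂ hx h20 h1 h2 heq
  · exact key T₂ T₁ hx h10 h2 h1 (heq.trans (add_comm _ _))

end IsStandardPair

theorem theorem1p1 {G : Type*} [Group G] (p q : ℕ) (hp : p.Prime) (hq : q.Prime)
    (hp2 : Odd p) (hq2 : Odd q) (hpq : p ∣ q - 1)
    (hcard : Nat.card G = p * q) (hG : ∃ a b : G, a * b ≠ b * a) (S : Multiset G) :
    (IsMinimalProductOne S ∧ Multiset.card S = 2 * q) ↔
      ∃ (x y : G) (s : ℕ), HasStandardPresentation p q s x y ∧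
        S = Multiset.replicate (q - 1) y + {x} + Multiset.replicate (q - 1) y +
          {x ^ (p - 1) * y ^ (s ^ (p - 1) + 1)} := by
  have : Fact p.Prime := ⟨hp⟩
  have : Fact q.Prime := ⟨hq⟩
  have hq1 := hq.two_le
  have hlt : p < q := by
    have := Nat.le_of_dvd (by omega) hpq
    omega
  constructor
  · rintro ⟨hS, hSc⟩
    obtain ⟨s₀, x₀, y₀, h₀⟩ := exists_isStandardPair hlt hcard hG
    obtain ⟨c, -⟩ := h₀.exists_affineCoord hlt hcard
    obtain ⟨k, hk, hqk⟩ : ∃ k, 1 ≤ k ∧ q = 2 * k * p + 1 := by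
      obtain ⟨m, hm⟩ := hpq
      obtain ⟨j, hj⟩ := hq2
      have h2 : 2 ∣ p * m := ⟨j, by omega⟩
      obtain ⟨k, rfl⟩ := (Nat.Coprime.dvd_mul_left (Nat.coprime_two_left.2 hp2)).1 h2
      refine ⟨k, Nat.pos_of_ne_zero ?_, ?_⟩
      · rintro rfl
        simp at hm; omega
      · rw [show 2 * k * p = p * (2 * k) by ring, ← hm]; omega
    obtain ⟨x, y, hx, hy, hb, rfl⟩ := c.exists_eq_replicate hp2 hk hqk hS hSc
    have hxy := c.isStandardPair hx hy hb
    exact ⟨x, y, _, hxy.hasStandardPresentation hlt hcard, by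
      rw [← hxy.conj_inv, Multiset.replicate_add_singleton_add hq.one_le]⟩
  · rintro ⟨x, y, s, h, rfl⟩
    have hxy := h.isStandardPair hG
    rw [← hxy.conj_inv, Multiset.replicate_add_singleton_add hq.one_le]
    refine ⟨hxy.isMinimalProductOne hlt hcard, ?_⟩
    simp
    omega
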